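/- Let $N\ge 2$, let $M\in\{0,\tfrac12,1,\dots\}$, and let $\Sigma$ be the complex vector space with basis $|s_1,\dots,s_N\rangle$, $s_i\in\{-M,-M+1,\dots,M\}$. For rational functions of $z=(z_1,\dots,z_N)$ with values in $\Sigma$, let $K_{ij}$ exchange the variables $z_i,z_j$, and let $$\Lambda=\frac1{N!}\sum_{\pi\in S_N}K_\pi S_\pi$$ be the projection onto states symmetric under simultaneous permutations of the variables and of the spins. A vector of $\Sigma$ is called symmetric if it is fixed by all permutations of the spins; these vectors form $\Lambda\Sigma$. Put $\mathcal P^n=\{p\in\mathbb C[z]:\deg p\le n\}$, $\sigma_k=\sum_i z_i^k$, $\tau_k=\sum_{i_1<\dots<i_k}z_{i_1}\cdots z_{i_k}$. For $|s\rangle\in\Sigma$ define $|s_{ij}\rangle=|s_{ji}\rangle\in\Sigma$ $(i\neq j)$ by $\Lambda(z_1z_2|s\rangle)=\sum_{i<j}z_iz_j|s_{ij}\rangle$, and let $$\Sigma'=\Big\{|s\rangle\in\Sigma:\ \sum_i|s_{i,i+1}\rangle\ \text{is symmetric}\Big\}.$$ Indices are cyclic ($N+1\equiv1$). For $a\in\mathbb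 R$ and $\epsilon=0,1,2$ let $$T_\epsilon=\sum_iz_i^\epsilon\partial_i^2+2a\sum_i\frac{1}{z_i-z_{i+1}}\big(z_i^\epsilon\partial_i-z_{i+1}^\epsilon\partial_{i+1}\big)-2a\sum_i\frac{\vartheta_\epsilon(z_i,z_{i+1})}{(z_i-z_{i+1})^2}(1-K_{i,i+1}),$$ acting on the variables only, where $\vartheta_0(x,y)=1$, $\vartheta_1(x,y)=\frac12(x+y)$, $\vartheta_2(x,y)=xy$. For $n\ge0$ let $$\mathcal T_0^n=\big\langle f(\sigma_1,\sigma_2,\sigma_3)\Lambda|s\rangle,\ g(\sigma_1,\sigma_2,\sigma_3)\Lambda(z_1|s\rangle),\ h(\sigma_1,\sigma_2)\Lambda(z_1^2|s\rangle),\ \tilde h(\sigma_1,\sigma_2)\Lambda(z_1z_2|s'\rangle)\ \big|\ f_{33}=g_{33}=0\big\rangle,$$ $$\mathcal T_1^n=\big\langle f(\sigma_1,\sigma_2,\tau_N)\Lambda|s\rangle,\ g(\sigma_1,\tau_N)\Lambda(z_1|s\rangle)\ \big|\ f_{22}=f_{NN}=g_{NN}=0\big\rangle,$$ $$\mathcal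 T_2^n=\big\langle f(\sigma_1,\tau_{N-1},\tau_N)\Lambda|s\rangle,\ g(\tau_{N-1},\tau_N)\Lambda(z_1|s\rangle),\ \tau_Nq(\sigma_1,\tau_N)\Lambda(z_1^{-1}|s\rangle)\ \big|\ f_{11}=f_{N-1,N-1}=g_{N-1,N-1}=q_{11}=0\big\rangle$$ be the complex linear spans over all $|s\rangle\in\Sigma$, $|s'\rangle\in\Sigma'$ and all polynomials $f,g,h,\tilde h,q$ in the indicated arguments which, as polynomials in $z$, satisfy $\deg f\le n$, $\deg g\le n-1$, $\deg h\le n-2$, $\deg\tilde h\le n-2$, $\deg q\le n-N+1$ (a negative bound forces the zero polynomial). Here the arguments are treated as formal variables and a subscript $k$ denotes the partial derivative with respect to the argument $\sigma_k$ ($k=1,2,3$) or $\tau_k$ ($k=N-1,N$): $f_1,f_2,f_3$ refer to $\sigma_1,\sigma_2,\sigma_3$, and $f_{N-1},f_N$ to $\tau_{N-1},\tau_N$. Then for every $\epsilon=0,1,2$ and every $n=0,1,\dots$ the space $\mathcal T_\epsilon^n$ is invariant under $T_\epsilon$. Moreover $\mathcal T^n_\epsilon$ is a finite-dimensional subspace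 of $\Lambda(\mathcal P^n\otimes\Sigma)$; $\mathcal T_\epsilon^0\subseteq\mathcal T_\epsilon^1\subseteq\cdots$; and if $M>0$ and $n\ge1$, then $\mathcal T_\epsilon^n$ is strictly larger than the span of its factorized generators $f\Lambda|s\rangle$. If $N\ge4$ and $a\ne0$, then $T_\epsilon$ does not commute with $\Lambda$ on the polynomials with values in $\Sigma$. -/

import Mathlib

open scoped Nat

namespace CyclicDunkl

noncomputable section

/-- Complex polynomials in `z_1, …, z_N`; the coordinates are indexed by `Fin N`, so that
`z_1` is the coordinate `0`, and `i + 1` is the cyclic successor of `i`. -/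
abbrev Poly (N : ℕ) : Type := MvPolynomial (Fin N) ℂ

/-- Complex rational functions in `z_1, …, z_N`: the fraction field of `Poly N`. -/
def RatFun (N : ℕ) : Type := FractionRing (Poly N)

instance (N : ℕ) : Field (RatFun N) := inferInstanceAs (Field (FractionRing (Poly N)))

instance (N : ℕ) : Algebra (Poly N) (RatFun N) :=
  inferInstanceAs (Algebra (Poly N) (FractionRing (Poly N)))

instance (N : ℕ) : IsFractionRing (Poly N) (RatFun N) :=
  inferInstanceAs (IsFractionRing (Poly N) (FractionRing (Poly N)))

instance (N : ℕ) : Algebra ℂ (RatFun N) :=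
  ((algebraMap (Poly N) (RatFun N)).comp (algebraMap ℂ (Poly N))).toAlgebra

instance (N : ℕ) : IsScalarTower ℂ (Poly N) (RatFun N) :=
  IsScalarTower.of_algebraMap_eq fun _ => rfl

/-- The coordinate `z_i` as a rational function. -/
def z {N : ℕ} (i : Fin N) : RatFun N := algebraMap (Poly N) (RatFun N) (MvPolynomial.X i)

/-! ### Partial derivatives and permutations of the variables on rational functions -/

/-- The quotient rule: the value at `f = p / q` is `(D p * q - p * D q) / q ^ 2`, for one choice
of `p` and `q`. -/
def quotientRule {R A K : Type} [CommRing R] [CommRing A] [Algebra R A] [Field K] [Algebra A K]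
    [IsFractionRing A K] (D : Derivation R A A) (f : K) : K :=
  let p := (IsLocalization.sec (nonZeroDivisors A) f).1
  let q := (IsLocalization.sec (nonZeroDivisors A) f).2.1
  algebraMap A K (D p * q - p * D q) / algebraMap A K q ^ 2

theorem algebraMap_ne_zero_of {A K : Type} [CommRing A] [IsDomain A] [Field K] [Algebra A K]
    [IsFractionRing A K] {q : A} (hq : q ≠ 0) : algebraMap A K q ≠ 0 := fun h =>
  hq (IsFractionRing.injective A K (by rw [h, map_zero]))

theorem quotientRule_div {R A K : Type} [CommRing R] [CommRing A] [IsDomain A] [Algebra R A]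
    [Field K] [Algebra A K] [IsFractionRing A K] (D : Derivation R A A) (p q : A) (hq : q ≠ 0) :
    quotientRule D (algebraMap A K p / algebraMap A K q) =
      algebraMap A K (D p * q - p * D q) / algebraMap A K q ^ 2 := by
  set f : K := algebraMap A K p / algebraMap A K q with hf
  have hinj := IsFractionRing.injective A K
  set u := (IsLocalization.sec (nonZeroDivisors A) f).1 with hu
  set v := (IsLocalization.sec (nonZeroDivisors A) f).2.1 with hv
  have hv0 : v ≠ 0 := nonZeroDivisors.ne_zero (IsLocalization.sec (nonZeroDivisors A) f).2.2
  have hq' : algebraMap A K q ≠ 0 := algebraMap_ne_zero_of hq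
  have hv' : algebraMap A K v ≠ 0 := algebraMap_ne_zero_of hv0
  have huv : f * algebraMap A K v = algebraMap A K u :=
    IsLocalization.sec_spec (nonZeroDivisors A) f
  have hcross : u * q = p * v := by
    apply hinj
    rw [map_mul, map_mul, ← huv, hf]
    field_simp
  have hd := congrArg D hcross
  simp only [Derivation.leibniz, smul_eq_mul] at hd
  change algebraMap A K (D u * v - u * D v) / algebraMap A K v ^ 2 = _
  rw [div_eq_div_iff (pow_ne_zero 2 hv') (pow_ne_zero 2 hq'), ← map_pow, ← map_pow,
    ← map_mul, ← map_mul]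
  congr 1
  linear_combination (q * v) * hd - (q * D v + v * D q) * hcross

theorem exists_eq_div {A K : Type} [CommRing A] [IsDomain A] [Field K] [Algebra A K]
    [IsFractionRing A K] (f : K) :
    ∃ p q : A, q ≠ 0 ∧ f = algebraMap A K p / algebraMap A K q := by
  obtain ⟨p, q, hq, h⟩ := IsFractionRing.div_surjective (A := A) f
  exact ⟨p, q, nonZeroDivisors.ne_zero hq, h.symm⟩

/-- The extension of a derivation to the fraction field. -/
def extendDerivation {R A K : Type} [CommRing R] [CommRing A] [IsDomain A] [Algebra R A]
    [Field K] [Algebra A K] [IsFractionRing A K] [Algebra R K] [IsScalarTower R A K]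
    (D : Derivation R A A) : Derivation R K K :=
  Derivation.mk'
    { toFun := quotientRule D
      map_add' := by
        intro f g
        obtain ⟨p, q, hq, rfl⟩ := exists_eq_div (A := A) f
        obtain ⟨r, s, hs, rfl⟩ := exists_eq_div (A := A) g
        have hq' : algebraMap A K q ≠ 0 := algebraMap_ne_zero_of hq
        have hs' : algebraMap A K s ≠ 0 := algebraMap_ne_zero_of hs
        rw [div_add_div _ _ hq' hs', ← map_mul, ← map_mul, ← map_mul, ← map_add,
          quotientRule_div D _ _ (mul_ne_zero hq hs), quotientRule_div D p q hq,
          quotientRule_div D r s hs]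
        simp only [Derivation.leibniz, smul_eq_mul, map_add, map_sub, map_mul]
        field_simp
        ring
      map_smul' := by
        intro c f
        obtain ⟨p, q, hq, rfl⟩ := exists_eq_div (A := A) f
        have h : c • (algebraMap A K p / algebraMap A K q) =
            algebraMap A K (c • p) / algebraMap A K q := by
          rw [Algebra.smul_def, Algebra.smul_def, IsScalarTower.algebraMap_apply R A K, map_mul,
            mul_div_assoc]
        rw [h, quotientRule_div D _ _ hq, quotientRule_div D p q hq, RingHom.id_apply,
          Derivation.map_smul, Algebra.smul_def, Algebra.smul_def, Algebra.smul_def,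
          IsScalarTower.algebraMap_apply R A K]
        simp only [map_sub, map_mul]
        ring }
    (by
      intro f g
      obtain ⟨p, q, hq, rfl⟩ := exists_eq_div (A := A) f
      obtain ⟨r, s, hs, rfl⟩ := exists_eq_div (A := A) g
      have hq' : algebraMap A K q ≠ 0 := algebraMap_ne_zero_of hq
      have hs' : algebraMap A K s ≠ 0 := algebraMap_ne_zero_of hs
      change quotientRule D _ = _ * quotientRule D _ + _ * quotientRule D _
      rw [div_mul_div_comm, ← map_mul, ← map_mul,
        quotientRule_div D _ _ (mul_ne_zero hq hs), quotientRule_div D p q hq,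
        quotientRule_div D r s hs]
      simp only [Derivation.leibniz, smul_eq_mul, map_add, map_sub, map_mul]
      field_simp
      ring)

theorem extendDerivation_algebraMap {R A K : Type} [CommRing R] [CommRing A] [IsDomain A]
    [Algebra R A] [Field K] [Algebra A K] [IsFractionRing A K] [Algebra R K]
    [IsScalarTower R A K] (D : Derivation R A A) (p : A) :
    extendDerivation D (algebraMap A K p) = algebraMap A K (D p) := by
  have h := quotientRule_div (K := K) D p 1 one_ne_zero
  rw [map_one, div_one, Derivation.map_one_eq_zero] at h
  change quotientRule D _ = _
  simpa using h

/-- The partial derivative `∂_i = ∂/∂z_i` on rational functions. -/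
def pd {N : ℕ} (i : Fin N) : Derivation ℂ (RatFun N) (RatFun N) :=
  extendDerivation (MvPolynomial.pderiv i : Derivation ℂ (Poly N) (Poly N))

theorem pd_algebraMap {N : ℕ} (i : Fin N) (p : Poly N) :
    pd i (algebraMap (Poly N) (RatFun N) p) =
      algebraMap (Poly N) (RatFun N) (MvPolynomial.pderiv i p) :=
  extendDerivation_algebraMap _ p

/-- The operator `K_π` that permutes the variables: `z_i ↦ z_{π i}`. -/
def permVar {N : ℕ} (π : Equiv.Perm (Fin N)) : RatFun N ≃ₐ[ℂ] RatFun N :=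
  IsFractionRing.algEquivOfAlgEquiv (MvPolynomial.renameEquiv ℂ π)

theorem permVar_z {N : ℕ} (π : Equiv.Perm (Fin N)) (i : Fin N) :
    permVar π (z i) = z (π i) := by
  simp [permVar, z]

/-! ### The operators `T_ε` -/

/-- `ϑ_0(x, y) = 1`, `ϑ_1(x, y) = (x + y) / 2`, `ϑ_2(x, y) = x y`. -/
def theta {N : ℕ} (ε : Fin 3) (x y : RatFun N) : RatFun N :=
  match ε with
  | 0 => 1
  | 1 => (x + y) / 2
  | 2 => x * y

/-- `T_ε = ∑ z_i^ε ∂_i² + 2a ∑ (z_i - z_{i+1})⁻¹ (z_i^ε ∂_i - z_{i+1}^ε ∂_{i+1})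
  - 2a ∑ ϑ_ε(z_i, z_{i+1}) (z_i - z_{i+1})⁻² (1 - K_{i,i+1})` on rational functions, with cyclic
indices. -/
def TScalar {N : ℕ} [NeZero N] (ε : Fin 3) (a : ℝ) : RatFun N →ₗ[ℂ] RatFun N where
  toFun f :=
    ∑ i, z i ^ (ε : ℕ) * pd i (pd i f)
      + (2 * a : ℂ) • ∑ i, 1 / (z i - z (i + 1)) *
          (z i ^ (ε : ℕ) * pd i f - z (i + 1) ^ (ε : ℕ) * pd (i + 1) f)
      - (2 * a : ℂ) • ∑ i, theta ε (z i) (z (i + 1)) / (z i - z (i + 1)) ^ 2 *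
          (f - permVar (Equiv.swap i (i + 1)) f)
  map_add' f g := by
    simp only [map_add, mul_add, add_sub_add_comm, Finset.sum_add_distrib, smul_add]
    abel
  map_smul' c f := by
    simp only [Derivation.map_smul, map_smul, mul_smul_comm, ← smul_sub, ← Finset.smul_sum, RingHom.id_apply,
      smul_comm (2 * a : ℂ) c, ← smul_add]

/-! ### Spin vectors and vector-valued rational functions -/

/-- A spin configuration `(s_1, …, s_N)` of `N` particles of spin `M = k / 2`: each of the
`2M + 1 = k + 1` values `-M, -M + 1, …, M` is represented by an element of `Fin (k + 1)`. -/
abbrev Config (N k : ℕ) : Type := Fin N → Fin (k + 1)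

/-- The spin space `Σ`, with basis `|s_1, …, s_N⟩`: a vector is given by its coordinates. -/
abbrev Spin (N k : ℕ) : Type := Config N k → ℂ

/-- Rational functions with values in `Σ`, given by their coordinates in the basis
`|s_1, …, s_N⟩`. -/
abbrev State (N k : ℕ) : Type := Config N k → RatFun N

/-- The permutation `S_π` of the spins: it sends `|s⟩` to `|s ∘ π⁻¹⟩`, so it moves the spin of
particle `i` to particle `π i`. -/
def permSpin {N k : ℕ} (π : Equiv.Perm (Fin N)) : Spin N k →ₗ[ℂ] Spin N k where
  toFun v := fun s => v (s ∘ π)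
  map_add' _ _ := rfl
  map_smul' _ _ := rfl

/-- A spin vector is symmetric if it is fixed by all permutations of the spins. -/
def IsSymmSpin {N k : ℕ} (v : Spin N k) : Prop := ∀ π : Equiv.Perm (Fin N), permSpin π v = v

/-- The factorized vector-valued function `f |v⟩`. -/
def ket {N k : ℕ} (f : RatFun N) (v : Spin N k) : State N k := fun s => v s • f

/-- The simultaneous permutation `K_π S_π` of the variables and the spins. -/
def permState {N k : ℕ} (π : Equiv.Perm (Fin N)) : State N k →ₗ[ℂ] State N k where
  toFun Ψ := fun s => permVar π (Ψ (s ∘ π))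
  map_add' Ψ Φ := by
    funext s
    simp
  map_smul' c Ψ := by
    funext s
    simp

theorem permState_ket {N k : ℕ} (π : Equiv.Perm (Fin N)) (f : RatFun N) (v : Spin N k) :
    permState π (ket f v) = ket (permVar π f) (permSpin π v) := by
  funext s
  simp [permState, ket, permSpin]

/-- The projection `Λ` on states symmetric under simultaneous permutations. -/
def Lam {N k : ℕ} : State N k →ₗ[ℂ] State N k :=
  ((N ! : ℂ)⁻¹) • ∑ π : Equiv.Perm (Fin N), permState π

/-- `T_ε` on vector-valued functions: it acts on the variables only. -/
def T {N k : ℕ} [NeZero N] (ε : Fin 3) (a : ℝ) : State N k →ₗ[ℂ] State N k :=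
  (TScalar ε a).compLeft (Config N k)

/-- The space `𝒫ⁿ ⊗ Σ` of vector-valued polynomials of degree at most `n`. -/
def polyState (N k n : ℕ) : Submodule ℂ (State N k) :=
  Submodule.pi Set.univ fun _ =>
    (MvPolynomial.restrictTotalDegree (Fin N) ℂ n).map
      (IsScalarTower.toAlgHom ℂ (Poly N) (RatFun N)).toLinearMap

/-- The subspace `Σ'` of the spin vectors `v` for which `∑_i |v_{i,i+1}⟩` is symmetric, where
the vectors `|v_{ij}⟩ = |v_{ji}⟩`, `i ≠ j`, are determined by
`Λ(z_1 z_2 |v⟩) = ∑_{i < j} z_i z_j |v_{ij}⟩`. -/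
def SpinPrime (N k : ℕ) [NeZero N] : Set (Spin N k) :=
  {v | ∃ w : Fin N → Fin N → Spin N k, (∀ i j, w i j = w j i) ∧
    Lam (ket (z 0 * z 1) v) =
      ∑ i, ∑ j ∈ Finset.univ.filter (fun j => i < j), ket (z i * z j) (w i j) ∧
    IsSymmSpin (∑ i, w i (i + 1))}

/-! ### The invariant spaces -/

/-- The power sum `σ_m = ∑ z_i^m`. -/
abbrev sig (N m : ℕ) : Poly N := MvPolynomial.psum (Fin N) ℂ m

/-- The elementary symmetric polynomial `τ_m`. -/
abbrev tau (N m : ℕ) : Poly N := MvPolynomial.esymm (Fin N) ℂ m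

/-- `f(u_1, …, u_r)` for a polynomial `f` in `r` variables and `u_1, …, u_r ∈ ℂ[z]`. -/
abbrev subst {N r : ℕ} (u : Fin r → Poly N) (f : MvPolynomial (Fin r) ℂ) : Poly N :=
  MvPolynomial.aeval u f

/-- The second partial derivative of `f` with respect to its variable number `i`
(counted from `0`). -/
abbrev pd2 {r : ℕ} (i : Fin r) (f : MvPolynomial (Fin r) ℂ) : MvPolynomial (Fin r) ℂ :=
  MvPolynomial.pderiv i (MvPolynomial.pderiv i f)

/-- The factorized states `f Λ|s⟩` among the generators of `𝒯_εⁿ`. -/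
def genF (N k : ℕ) (ε : Fin 3) (n : ℕ) : Set (State N k) :=
  match ε with
  | 0 => {Ψ | ∃ (f : MvPolynomial (Fin 3) ℂ) (s : Spin N k),
      pd2 2 f = 0 ∧ (subst ![sig N 1, sig N 2, sig N 3] f).totalDegree ≤ n ∧
      Ψ = subst ![sig N 1, sig N 2, sig N 3] f • Lam (ket 1 s)}
  | 1 => {Ψ | ∃ (f : MvPolynomial (Fin 3) ℂ) (s : Spin N k),
      pd2 1 f = 0 ∧ pd2 2 f = 0 ∧ (subst ![sig N 1, sig N 2, tau N N] f).totalDegree ≤ n ∧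
      Ψ = subst ![sig N 1, sig N 2, tau N N] f • Lam (ket 1 s)}
  | 2 => {Ψ | ∃ (f : MvPolynomial (Fin 3) ℂ) (s : Spin N k),
      pd2 0 f = 0 ∧ pd2 1 f = 0 ∧
      (subst ![sig N 1, tau N (N - 1), tau N N] f).totalDegree ≤ n ∧
      Ψ = subst ![sig N 1, tau N (N - 1), tau N N] f • Lam (ket 1 s)}

/-- The generators `g Λ(z_1|s⟩)` of `𝒯_εⁿ`. -/
def genG (N k : ℕ) [NeZero N] (ε : Fin 3) (n : ℕ) : Set (State N k) :=
  match ε with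
  | 0 => {Ψ | ∃ (g : MvPolynomial (Fin 3) ℂ) (s : Spin N k),
      pd2 2 g = 0 ∧ (subst ![sig N 1, sig N 2, sig N 3] g).totalDegree + 1 ≤ n ∧
      Ψ = subst ![sig N 1, sig N 2, sig N 3] g • Lam (ket (z 0) s)}
  | 1 => {Ψ | ∃ (g : MvPolynomial (Fin 2) ℂ) (s : Spin N k),
      pd2 1 g = 0 ∧ (subst ![sig N 1, tau N N] g).totalDegree + 1 ≤ n ∧
      Ψ = subst ![sig N 1, tau N N] g • Lam (ket (z 0) s)}
  | 2 => {Ψ | ∃ (g : MvPolynomial (Fin 2) ℂ) (s : Spin N k),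
      pd2 0 g = 0 ∧ (subst ![tau N (N - 1), tau N N] g).totalDegree + 1 ≤ n ∧
      Ψ = subst ![tau N (N - 1), tau N N] g • Lam (ket (z 0) s)}

/-- The remaining generators of `𝒯_εⁿ`: for `ε = 0` the states `h Λ(z_1²|s⟩)` and
`h̃ Λ(z_1 z_2|s'⟩)` with `s' ∈ Σ'`, none for `ε = 1`, and for `ε = 2` the states
`τ_N q Λ(z_1⁻¹|s⟩)` with `deg q ≤ n - N + 1`. -/
def genH (N k : ℕ) [NeZero N] (ε : Fin 3) (n : ℕ) : Set (State N k) :=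
  match ε with
  | 0 => {Ψ | ∃ (h : MvPolynomial (Fin 2) ℂ) (s : Spin N k),
        (subst ![sig N 1, sig N 2] h).totalDegree + 2 ≤ n ∧
        Ψ = subst ![sig N 1, sig N 2] h • Lam (ket (z 0 ^ 2) s)} ∪
      {Ψ | ∃ (h : MvPolynomial (Fin 2) ℂ) (s' : Spin N k), s' ∈ SpinPrime N k ∧
        (subst ![sig N 1, sig N 2] h).totalDegree + 2 ≤ n ∧
        Ψ = subst ![sig N 1, sig N 2] h • Lam (ket (z 0 * z 1) s')}
  | 1 => ∅
  | 2 => {Ψ | ∃ (q : MvPolynomial (Fin 2) ℂ) (s : Spin N k),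
      pd2 0 q = 0 ∧ (subst ![sig N 1, tau N N] q).totalDegree + N ≤ n + 1 ∧
      Ψ = (tau N N * subst ![sig N 1, tau N N] q) • Lam (ket (z 0)⁻¹ s)}

/-- The space `𝒮_εⁿ ⊗ ΛΣ` spanned by the factorized states. -/
def factorized (N k : ℕ) (ε : Fin 3) (n : ℕ) : Submodule ℂ (State N k) :=
  Submodule.span ℂ (genF N k ε n)

/-- The space `𝒯_εⁿ`. -/
def invSpace (N k : ℕ) [NeZero N] (ε : Fin 3) (n : ℕ) : Submodule ℂ (State N k) :=
  Submodule.span ℂ (genF N k ε n ∪ genG N k ε n ∪ genH N k ε n)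

end

end CyclicDunkl

open CyclicDunkl

namespace CyclicDunkl

open MvPolynomial

/-! ### Weight bounds for formal polynomials -/

/-! Write Γ_ε(f, g) = ∑ z_i^ε ∂_i f ∂_i g. The product rule for `T_ε` has two correction terms:
2Γ_ε(f, g), and a difference term built from the products (f - Kf)(g - Kg) over neighbouring pairs
(`TScalar_mul`). The difference term vanishes when f is symmetric. Hence on a product of a symmetric
coefficient F(u) and a seed Λ(f|s⟩), invariance comes down to three computations, combined in
`T_subst_smul`.

The first is `T_ε` on coefficients. On symmetric functions it is a second-order differential
operator, so only its values on the arguments u_k and the numbers Γ_ε(u_k, u_l) matter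
(`TScalar_subst`). These are polynomials in the arguments except for certain diagonal Γ_ε(u_k, u_k),
and the conditions of the form f_kk = 0 remove exactly those. What remains is the operator
`formalT`.

The second is `T_ε` on the seeds z_1, z_1², z_1⁻¹ and z_1z_2. For the first three the value depends
only on the variable and not on its place in the cycle, so `T_ε` can be moved past Λ on them
although it does not commute with Λ in general (`T_Lam_ket`). For z_1z_2 only neighbouring pairs
contribute; the result is a multiple of ∑|s_{i,i+1}⟩, and Σ' is the condition that makes it
symmetric (`T_Lam_ket_z_mul_z`).

The third is Γ_ε between an argument and a seed, which gives a seed of another or the same family,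
multiplied by a first derivative of the coefficient. That derivative has the smaller degree and the
smaller exponents required there.

All side conditions are bounds on integer weights of formal monomials: degree, exponent at most 1 or
0 in one variable, and, with weight -1, divisibility by τ_N. Thus a few inequalities on weights
prove that `formalT` preserves all of them. Since the degree bounds of the statement concern values,
and the arguments may be algebraically dependent, coefficients are first truncated by
`exists_weightLE`.

Of the other claims, strictness holds because factorized states have symmetric coordinates while
Λ(z_1|s⟩) need not. Failure of commutation is seen on (z_1z_2 - z_1z_3)|s⟩ for a
permutation-invariant |s⟩: Λ kills this state, but `T_ε` distinguishes neighbours from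
non-neighbours. -/

/-- Every monomial of `f` has weight at most `n`. -/
def WeightLE {r : ℕ} (w : Fin r → ℤ) (n : ℤ) (f : MvPolynomial (Fin r) ℂ) : Prop :=
  ∀ m, coeff m f ≠ 0 → ∑ i, w i * (m i : ℤ) ≤ n

namespace WeightLE

variable {r : ℕ} {w : Fin r → ℤ} {n n' : ℤ} {f g : MvPolynomial (Fin r) ℂ}

theorem mono (h : WeightLE w n f) (hn : n ≤ n') : WeightLE w n' f :=
  fun m hm => (h m hm).trans hn

theorem add (hf : WeightLE w n f) (hg : WeightLE w n g) : WeightLE w n (f + g) := by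
  intro m hm
  by_cases h : coeff m f = 0
  · exact hg m (by simpa [h] using hm)
  · exact hf m h

theorem sum {ι : Type*} (s : Finset ι) (F : ι → MvPolynomial (Fin r) ℂ)
    (h : ∀ i ∈ s, WeightLE w n (F i)) : WeightLE w n (∑ i ∈ s, F i) := by
  intro m hm
  rw [coeff_sum] at hm
  obtain ⟨i, hi, hne⟩ := Finset.exists_ne_zero_of_sum_ne_zero hm
  exact h i hi m hne

theorem smul (c : ℂ) (hf : WeightLE w n f) : WeightLE w n (c • f) := by
  intro m hm
  exact hf m (by rw [coeff_smul] at hm; exact right_ne_zero_of_smul hm)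

theorem X_mul (i : Fin r) (hf : WeightLE w (n - w i) f) :
    WeightLE w n (X i * f) := by
  intro m hm
  rw [coeff_X_mul'] at hm
  split_ifs at hm with hi
  · have h := hf _ hm
    have hle : Finsupp.single i 1 ≤ m := by
      rw [Finsupp.single_le_iff]
      exact Nat.one_le_iff_ne_zero.mpr (Finsupp.mem_support_iff.mp hi)
    obtain ⟨m', rfl⟩ := exists_add_of_le hle
    rw [add_tsub_cancel_left] at h
    simp only [Finsupp.add_apply, Nat.cast_add, mul_add, Finset.sum_add_distrib]
    have : ∑ j, w j * ((Finsupp.single i 1 j : ℕ) : ℤ) = w i := by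
      simp [Finsupp.single_apply]
    linarith
  · exact absurd rfl hm

theorem pderiv (i : Fin r) (hf : WeightLE w (n + w i) f) :
    WeightLE w n (MvPolynomial.pderiv i f) := by
  intro m hm
  rw [coeff_pderiv] at hm
  have h := hf _ (left_ne_zero_of_mul hm)
  simp only [Finsupp.add_apply, Nat.cast_add, mul_add, Finset.sum_add_distrib] at h
  have : ∑ j, w j * ((Finsupp.single i 1 j : ℕ) : ℤ) = w i := by
    simp [Finsupp.single_apply]
  linarith

theorem eq_zero (hf : WeightLE w n f) (hn : n < 0) (hw : ∀ i, 0 ≤ w i) : f = 0 := by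
  ext m
  by_contra h
  have h1 := hf m (by simpa using h)
  have h2 : 0 ≤ ∑ i, w i * (m i : ℤ) :=
    Finset.sum_nonneg fun i _ => mul_nonneg (hw i) (Int.natCast_nonneg _)
  omega

end WeightLE

theorem weightLE_single_iff {r : ℕ} (i : Fin r) (n : ℤ) (f : MvPolynomial (Fin r) ℂ) :
    WeightLE (Pi.single i 1) n f ↔ ∀ m, coeff m f ≠ 0 → (m i : ℤ) ≤ n := by
  simp [WeightLE, Pi.single_apply]

/-- In characteristic zero the second derivative multiplies each coefficient of exponent at least 2
by a nonzero number. This turns the conditions f_kk = 0 into weight bounds. -/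
theorem pd2_eq_zero_iff {r : ℕ} (i : Fin r) (f : MvPolynomial (Fin r) ℂ) :
    pd2 i f = 0 ↔ WeightLE (Pi.single i 1) 1 f := by
  rw [weightLE_single_iff]
  constructor
  · intro h m hm
    by_contra hlt
    push Not at hlt
    have hle : Finsupp.single i 2 ≤ m := by
      rw [Finsupp.single_le_iff]
      exact_mod_cast hlt
    obtain ⟨m', rfl⟩ := exists_add_of_le hle
    have hc := congrArg (coeff m') h
    rw [pd2, coeff_pderiv, coeff_pderiv, coeff_zero, add_assoc, ← Finsupp.single_add,
      add_comm m'] at hc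
    have h1 : ((m' i : ℂ) + 1) ≠ 0 := Nat.cast_add_one_ne_zero _
    have h2 : (((m' + Finsupp.single i (1 : ℕ) : Fin r →₀ ℕ) i : ℕ) : ℂ) + 1 ≠ 0 := Nat.cast_add_one_ne_zero _
    exact mul_ne_zero (mul_ne_zero hm h2) h1 hc
  · intro h
    ext m
    rw [pd2, coeff_pderiv, coeff_pderiv, coeff_zero]
    have : coeff (m + Finsupp.single i 1 + Finsupp.single i 1) f = 0 := by
      by_contra hne
      have := h _ hne
      simp at this
      omega
    simp [this]

theorem weightLE_rename_iff {r r' : ℕ} {e : Fin r → Fin r'} (he : Function.Injective e)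
    (w : Fin r' → ℤ) (n : ℤ) (f : MvPolynomial (Fin r) ℂ) :
    WeightLE w n (rename e f) ↔ WeightLE (w ∘ e) n f := by
  have key (m : Fin r →₀ ℕ) :
      ∑ i, w i * ((m.mapDomain e i : ℕ) : ℤ) = ∑ i, (w ∘ e) i * (m i : ℤ) := by
    have h := Finsupp.sum_mapDomain_index_inj (s := m) (h := fun i c => w i * (c : ℤ)) he
    rwa [Finsupp.sum_fintype _ _ (by simp), Finsupp.sum_fintype _ _ (by simp)] at h
  constructor
  · intro h m hm
    rw [← key]
    exact h _ (by rwa [coeff_rename_mapDomain _ he])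
  · intro h m hm
    obtain ⟨m', rfl, hm'⟩ := coeff_rename_ne_zero _ _ _ hm
    rw [key]
    exact h _ hm'

/-! ### Degree of a substituted polynomial versus formal weight -/

section Subst

variable {N r : ℕ} {u : Fin r → Poly N} {w : Fin r → ℕ}

theorem subst_monomial_isHomogeneous (hu : ∀ i, (u i).IsHomogeneous (w i)) (m : Fin r →₀ ℕ)
    (c : ℂ) : (subst u (monomial m c)).IsHomogeneous (∑ i, w i * m i) := by
  rw [subst, aeval_monomial, Finsupp.prod_fintype _ _ (fun i => pow_zero _)]
  exact (IsHomogeneous.prod _ _ _ fun i _ => (hu i).pow (m i)).C_mul c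

theorem totalDegree_subst_le (hu : ∀ i, (u i).IsHomogeneous (w i))
    {f : MvPolynomial (Fin r) ℂ} {n : ℤ} {d : ℕ} (hn : n ≤ d)
    (hf : WeightLE (fun i => (w i : ℤ)) n f) : (subst u f).totalDegree ≤ d := by
  rw [f.as_sum, subst, map_sum]
  refine totalDegree_finsetSum_le fun m hm => ?_
  refine (subst_monomial_isHomogeneous hu m _).totalDegree_le.trans ?_
  have h : ∑ i, (w i : ℤ) * (m i : ℤ) ≤ d := (hf m (mem_support_iff.mp hm)).trans hn
  exact_mod_cast h

/-- Each formal monomial takes a homogeneous value whose degree is its weight, so grading by weight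
and grading by degree correspond. -/
theorem homogeneousComponent_subst (hu : ∀ i, (u i).IsHomogeneous (w i)) (d : ℕ)
    (f : MvPolynomial (Fin r) ℂ) :
    homogeneousComponent d (subst u f) = subst u (weightedHomogeneousComponent w d f) := by
  classical
  rw [f.as_sum, subst, map_sum, map_sum, map_sum, subst, map_sum]
  refine Finset.sum_congr rfl fun m _ => ?_
  have hw : Finsupp.weight w m = ∑ i, w i * m i := by
    rw [Finsupp.weight_apply, Finsupp.sum_fintype _ _ (by simp)]
    simp [mul_comm]
  rw [homogeneousComponent_of_mem (subst_monomial_isHomogeneous hu m _),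
    weightedHomogeneousComponent_of_mem (isWeightedHomogeneous_monomial w m _ hw)]
  split_ifs
  · rfl
  · rw [map_zero]

/-- A polynomial in homogeneous arguments of positive degree can be truncated at the degree of its
value, without enlarging its support. -/
theorem exists_weightLE (hu : ∀ i, (u i).IsHomogeneous (w i)) (f : MvPolynomial (Fin r) ℂ)
    {n : ℕ} (hn : (subst u f).totalDegree ≤ n) :
    ∃ F : MvPolynomial (Fin r) ℂ, subst u F = subst u f ∧
      WeightLE (fun i => (w i : ℤ)) n F ∧
      ∀ i, pd2 i f = 0 → WeightLE (Pi.single i 1) 1 F := by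
  classical
  -- Components of weight above the degree of the value may be nonzero, because of relations between
  -- the arguments, but their values are vanishing homogeneous components; dropping them changes
  -- nothing.
  refine ⟨∑ d ∈ Finset.range ((subst u f).totalDegree + 1), weightedHomogeneousComponent w d f,
    ?_, ?_, ?_⟩
  · rw [subst, map_sum]
    simp_rw [← homogeneousComponent_subst hu]
    exact sum_homogeneousComponent _
  · refine WeightLE.sum _ _ fun d hd m hm => ?_
    rw [coeff_weightedHomogeneousComponent] at hm
    split_ifs at hm with h
    · rw [Finsupp.weight_apply, Finsupp.sum_fintype _ _ (by simp)] at h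
      have h' : ∑ i, w i * m i = d := by simpa [mul_comm] using h
      have : d ≤ n := by simp at hd; omega
      rw [← h'] at this
      change ∑ i, (w i : ℤ) * (m i : ℤ) ≤ n
      exact_mod_cast this
    · exact absurd rfl hm
  · intro i hi
    rw [pd2_eq_zero_iff] at hi
    refine WeightLE.sum _ _ fun d _ m hm => hi m ?_
    rw [coeff_weightedHomogeneousComponent] at hm
    split_ifs at hm with h
    · exact hm
    · exact absurd rfl hm

end Subst

/-! ### Derivatives and permutations of rational functions -/

noncomputable section

variable {N : ℕ}

/-- The embedding of the polynomials into the rational functions. -/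
abbrev ratMap (N : ℕ) : Poly N →+* RatFun N := algebraMap (Poly N) (RatFun N)

theorem ratMap_injective : Function.Injective (ratMap N) :=
  IsFractionRing.injective (Poly N) (RatFun N)

instance : CharZero (RatFun N) :=
  charZero_of_injective_algebraMap (algebraMap ℂ (RatFun N)).injective

theorem ratMap_smul (c : ℂ) (p : Poly N) : ratMap N (c • p) = c • ratMap N p :=
  (IsScalarTower.toAlgHom ℂ (Poly N) (RatFun N)).toLinearMap.map_smul c p

theorem z_injective : Function.Injective (z : Fin N → RatFun N) :=
  ratMap_injective.comp (X_injective)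

theorem z_ne_zero (i : Fin N) : (z i : RatFun N) ≠ 0 :=
  algebraMap_ne_zero_of (X_ne_zero i)

theorem z_sub_ne_zero {i j : Fin N} (h : i ≠ j) : (z i - z j : RatFun N) ≠ 0 :=
  sub_ne_zero.mpr fun e => h (z_injective e)

theorem pd_z (i j : Fin N) : pd i (z j) = if j = i then 1 else 0 := by
  rw [z, pd_algebraMap, pderiv_X, Pi.single_apply]
  split_ifs <;> simp

theorem pd_z_self (i : Fin N) : pd i (z i) = 1 := by simp [pd_z]

theorem pd_z_of_ne {i j : Fin N} (h : j ≠ i) : pd i (z j) = 0 := by simp [pd_z, h]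

theorem permVar_ratMap (π : Equiv.Perm (Fin N)) (p : Poly N) :
    permVar π (ratMap N p) = ratMap N (rename π p) := by
  simp [permVar, ratMap]

theorem permVar_ratMap_of_isSymmetric (π : Equiv.Perm (Fin N)) {p : Poly N} (hp : p.IsSymmetric) :
    permVar π (ratMap N p) = ratMap N p := by
  rw [permVar_ratMap, hp π]

/-- For polynomials this is the compatibility of partial derivatives with renaming; the quotient
rule carries it over to fractions. -/
theorem pd_permVar (π : Equiv.Perm (Fin N)) (i : Fin N) (f : RatFun N) :
    pd (π i) (permVar π f) = permVar π (pd i f) := by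
  have hpoly (p : Poly N) : pd (π i) (permVar π (ratMap N p)) = permVar π (pd i (ratMap N p)) := by
    rw [permVar_ratMap, pd_algebraMap, pd_algebraMap, pderiv_rename π.injective, permVar_ratMap]
  obtain ⟨p, q, hq, rfl⟩ := exists_eq_div (A := Poly N) f
  rw [map_div₀, Derivation.leibniz_div, Derivation.leibniz_div]
  simp only [smul_eq_mul, map_mul, map_sub, map_pow, map_inv₀, hpoly]

theorem add_one_ne_self [NeZero N] (hN : 2 ≤ N) (i : Fin N) : i + 1 ≠ i := by
  intro h
  rw [add_eq_left] at h
  have := congrArg Fin.val h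
  rw [Fin.val_one', Fin.val_zero] at this
  rw [Nat.mod_eq_of_lt (by omega)] at this
  omega

/-! ### The bilinear form `∑ z_i^ε ∂_i f ∂_i g` -/

/-- The derivation `g ↦ ∑ z_i^ε ∂_i f ∂_i g`. -/
def gam (ε : Fin 3) (f : RatFun N) : Derivation ℂ (RatFun N) (RatFun N) :=
  ∑ i, (z i ^ (ε : ℕ) * pd i f) • pd i

theorem gam_apply (ε : Fin 3) (f g : RatFun N) :
    gam ε f g = ∑ i, z i ^ (ε : ℕ) * pd i f * pd i g := by
  have h : (gam ε f : RatFun N → RatFun N) =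
      Derivation.coeFnAddMonoidHom (∑ i, (z i ^ (ε : ℕ) * pd i f) • pd i) := rfl
  rw [h, map_sum, Finset.sum_apply]
  rfl

theorem gam_comm (ε : Fin 3) (f g : RatFun N) : gam ε f g = gam ε g f := by
  simp only [gam_apply]
  exact Finset.sum_congr rfl fun i _ => by ring

theorem gam_z (ε : Fin 3) (f : RatFun N) (j : Fin N) :
    gam ε f (z j) = z j ^ (ε : ℕ) * pd j f := by
  simp [gam_apply, pd_z]

theorem permVar_gam (π : Equiv.Perm (Fin N)) (ε : Fin 3) (f g : RatFun N) :
    permVar π (gam ε f g) = gam ε (permVar π f) (permVar π g) := by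
  simp only [gam_apply, map_sum, map_mul, map_pow, permVar_z, ← pd_permVar]
  exact Equiv.sum_comp π fun i => z i ^ (ε : ℕ) * pd i (permVar π f) * pd i (permVar π g)

/-- The chain rule, for any derivation of the rational functions. It serves both the partial
derivatives and Γ_ε. -/
theorem derivation_subst {r : ℕ} (D : Derivation ℂ (RatFun N) (RatFun N)) (u : Fin r → Poly N)
    (F : MvPolynomial (Fin r) ℂ) :
    D (ratMap N (subst u F)) =
      ∑ l, ratMap N (subst u (pderiv l F)) * D (ratMap N (u l)) := by
  induction F using MvPolynomial.induction_on with
  | C c =>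
    have : ratMap N (subst u (C c)) = algebraMap ℂ (RatFun N) c := by
      rw [subst, aeval_C]; rfl
    rw [this, D.map_algebraMap]
    simp
  | add p q hp hq => simp only [map_add, hp, hq, add_mul, Finset.sum_add_distrib]
  | mul_X p j hp =>
    have h (l : Fin r) : ratMap N (subst u (pderiv l (p * X j))) =
        ratMap N (subst u p) * (if j = l then 1 else 0)
          + ratMap N (u j) * ratMap N (subst u (pderiv l p)) := by
      rw [Derivation.leibniz, pderiv_X, Pi.single_apply]
      simp only [smul_eq_mul, map_add, map_mul, subst, aeval_X]
      split_ifs <;> simp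
    simp only [h, add_mul, Finset.sum_add_distrib, mul_assoc, ← Finset.mul_sum, ← hp]
    simp only [map_mul, subst, aeval_X, Derivation.leibniz, smul_eq_mul]
    simp

theorem gam_subst_left {r : ℕ} (ε : Fin 3) (u : Fin r → Poly N) (F : MvPolynomial (Fin r) ℂ)
    (x : RatFun N) :
    gam ε (ratMap N (subst u F)) x =
      ∑ l, ratMap N (subst u (pderiv l F)) * gam ε (ratMap N (u l)) x := by
  rw [gam_comm, derivation_subst]
  simp only [gam_comm ε x]

theorem subst_isSymmetric {r : ℕ} {u : Fin r → Poly N} (hu : ∀ i, (u i).IsSymmetric)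
    (F : MvPolynomial (Fin r) ℂ) : (subst u F).IsSymmetric := by
  intro π
  have h : (rename π : Poly N →ₐ[ℂ] Poly N).comp (aeval u) = aeval u := by
    ext i : 1
    simpa using hu i π
  exact congrArg (fun t => t F) h

/-! ### The scalar operator -/

section Scalar

variable [NeZero N]

/-- The contribution of the pair `(i, i + 1)` to the coefficient of `2a` in `T_ε`. -/
def pairTerm (ε : Fin 3) (i : Fin N) (f : RatFun N) : RatFun N :=
  1 / (z i - z (i + 1)) * (z i ^ (ε : ℕ) * pd i f - z (i + 1) ^ (ε : ℕ) * pd (i + 1) f)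
    - theta ε (z i) (z (i + 1)) / (z i - z (i + 1)) ^ 2 * (f - permVar (Equiv.swap i (i + 1)) f)

theorem TScalar_apply (ε : Fin 3) (a : ℝ) (f : RatFun N) :
    TScalar ε a f = ∑ i, z i ^ (ε : ℕ) * pd i (pd i f) + (2 * a : ℂ) • ∑ i, pairTerm ε i f := by
  simp only [pairTerm, Finset.sum_sub_distrib, smul_sub]
  rw [← add_sub_assoc]
  rfl

theorem pairTerm_of_const (ε : Fin 3) (i : Fin N) {f : RatFun N} (h1 : pd i f = 0)
    (h2 : pd (i + 1) f = 0) (hf : permVar (Equiv.swap i (i + 1)) f = f) :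
    pairTerm ε i f = 0 := by
  simp [pairTerm, hf, h1, h2]

theorem pairTerm_mul (ε : Fin 3) (i : Fin N) (f g : RatFun N) :
    pairTerm ε i (f * g) = f * pairTerm ε i g + pairTerm ε i f * g +
      theta ε (z i) (z (i + 1)) / (z i - z (i + 1)) ^ 2 *
        ((f - permVar (Equiv.swap i (i + 1)) f) * (g - permVar (Equiv.swap i (i + 1)) g)) := by
  simp only [pairTerm, map_mul, Derivation.leibniz, smul_eq_mul]
  ring

/-- Second derivatives produce the term 2Γ_ε. The difference part fails the Leibniz rule through the
identity fg - Kf·Kg = f(g - Kg) + (f - Kf)g - (f - Kf)(g - Kg). -/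
theorem TScalar_mul (ε : Fin 3) (a : ℝ) (f g : RatFun N) :
    TScalar ε a (f * g) = f * TScalar ε a g + TScalar ε a f * g + 2 * gam ε f g +
      (2 * a : ℂ) • ∑ i, theta ε (z i) (z (i + 1)) / (z i - z (i + 1)) ^ 2 *
        ((f - permVar (Equiv.swap i (i + 1)) f) * (g - permVar (Equiv.swap i (i + 1)) g)) := by
  simp only [TScalar_apply, pairTerm_mul ε, gam_apply, Derivation.leibniz, smul_eq_mul,
    map_add, Finset.sum_add_distrib, mul_add, add_mul, Finset.mul_sum, Finset.sum_mul, smul_add,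
    Finset.smul_sum, mul_smul_comm, smul_mul_assoc]
  have e1 (i : Fin N) : z i ^ (ε : ℕ) * (f * pd i (pd i g)) = f * (z i ^ (ε : ℕ) * pd i (pd i g)) :=
    by ring
  have e2 (i : Fin N) : z i ^ (ε : ℕ) * (g * pd i (pd i f)) = z i ^ (ε : ℕ) * pd i (pd i f) * g :=
    by ring
  have e3 (i : Fin N) : (2 : RatFun N) * (z i ^ (ε : ℕ) * pd i f * pd i g) =
    z i ^ (ε : ℕ) * (pd i g * pd i f) + z i ^ (ε : ℕ) * (pd i f * pd i g) := by ring
  simp only [e1, e2, e3, Finset.sum_add_distrib]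
  abel

theorem TScalar_mul_of_symm (ε : Fin 3) (a : ℝ) {f : RatFun N} (hf : ∀ π, permVar π f = f)
    (g : RatFun N) :
    TScalar ε a (f * g) = f * TScalar ε a g + TScalar ε a f * g + 2 * gam ε f g := by
  simp [TScalar_mul, hf]

/-- On symmetric functions the terms with 1 - K vanish, so each pair term acts as a derivation and
only the ∂_i² contribute second derivatives of `F`. -/
theorem TScalar_subst {r : ℕ} (ε : Fin 3) (a : ℝ) {u : Fin r → Poly N}
    (hu : ∀ i, (u i).IsSymmetric) (F : MvPolynomial (Fin r) ℂ) :
    TScalar ε a (ratMap N (subst u F)) =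
      ∑ k, ratMap N (subst u (pderiv k F)) * TScalar ε a (ratMap N (u k))
        + ∑ k, ∑ l, ratMap N (subst u (pderiv l (pderiv k F))) *
            gam ε (ratMap N (u l)) (ratMap N (u k)) := by
  have hsym (G : MvPolynomial (Fin r) ℂ) (π) :
      permVar π (ratMap N (subst u G)) = ratMap N (subst u G) :=
    permVar_ratMap_of_isSymmetric π (subst_isSymmetric hu G)
  have hpair (i : Fin N) : pairTerm ε i (ratMap N (subst u F)) =
      ∑ k, ratMap N (subst u (pderiv k F)) * pairTerm ε i (ratMap N (u k)) := by
    simp only [pairTerm, hsym, permVar_ratMap_of_isSymmetric _ (hu _), sub_self, mul_zero, sub_zero,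
      derivation_subst _ u F, Finset.mul_sum, ← Finset.sum_sub_distrib]
    exact Finset.sum_congr rfl fun k _ => by ring
  simp only [TScalar_apply, hpair, derivation_subst (pd _) u, map_sum, Derivation.leibniz,
    smul_eq_mul, gam_apply, Finset.mul_sum, mul_add, Finset.smul_sum, mul_smul_comm,
    Finset.sum_add_distrib]
  rw [Finset.sum_comm (s := (Finset.univ : Finset (Fin N))) (t := (Finset.univ : Finset (Fin r)))
      (f := fun i k => (2 * a : ℂ) •
        (ratMap N (subst u (pderiv k F)) * pairTerm ε i (ratMap N (u k)))),
    Finset.sum_comm (s := (Finset.univ : Finset (Fin N))) (t := (Finset.univ : Finset (Fin r)))]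
  have e : ∑ i : Fin N, ∑ k, z i ^ (ε : ℕ) * (pd i (ratMap N (u k)) *
      ∑ l, ratMap N (subst u (pderiv l (pderiv k F))) * pd i (ratMap N (u l))) =
      ∑ k, ∑ l, ∑ i, ratMap N (subst u (pderiv l (pderiv k F))) *
        (z i ^ (ε : ℕ) * pd i (ratMap N (u l)) * pd i (ratMap N (u k))) := by
    simp only [Finset.mul_sum]
    rw [Finset.sum_comm]
    refine Finset.sum_congr rfl fun k _ => ?_
    rw [Finset.sum_comm]
    exact Finset.sum_congr rfl fun l _ => Finset.sum_congr rfl fun i _ => by ring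
  simp only [← Finset.mul_sum] at e ⊢
  rw [e]
  simp only [Finset.mul_sum, mul_left_comm]
  ring

end Scalar

end

noncomputable section

variable {N : ℕ}

/-! ### Values on monomials of low degree -/

theorem permVar_swap_z_left (i j : Fin N) : permVar (Equiv.swap i j) (z i) = z j := by
  rw [permVar_z, Equiv.swap_apply_left]

theorem permVar_swap_z_right (i j : Fin N) : permVar (Equiv.swap i j) (z j) = z i := by
  rw [permVar_z, Equiv.swap_apply_right]

theorem permVar_swap_z_of_ne {i j l : Fin N} (h1 : l ≠ i) (h2 : l ≠ j) :
    permVar (Equiv.swap i j) (z l) = z l := by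
  rw [permVar_z, Equiv.swap_apply_of_ne_of_ne h1 h2]

theorem pd_pd_z (i j : Fin N) : pd i (pd i (z j)) = 0 := by
  rw [pd_z]
  split_ifs <;> simp

theorem gam_z_z_of_ne (ε : Fin 3) {j l : Fin N} (hjl : j ≠ l) :
    gam ε (z j) (z l) = 0 := by
  rw [gam_z, pd_z_of_ne hjl, mul_zero]

theorem pd_z_inv (i j : Fin N) : pd i (z j)⁻¹ = if j = i then -(z j)⁻¹ ^ 2 else 0 := by
  rw [Derivation.leibniz_inv, pd_z]
  split_ifs <;> simp

theorem pd_sig (i : Fin N) (m : ℕ) : pd i (ratMap N (sig N m)) = m * z i ^ (m - 1) := by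
  have h : ratMap N (sig N m) = ∑ j, z j ^ m := by simp [sig, psum, z]
  rw [h, map_sum, Finset.sum_eq_single i]
  · simp [Derivation.leibniz_pow, pd_z_self]
  · intro j _ hj
    simp [Derivation.leibniz_pow, pd_z_of_ne hj]
  · simp

theorem pd_pd_sig (i : Fin N) (m : ℕ) :
    pd i (pd i (ratMap N (sig N m))) = m * ((m - 1 : ℕ) * z i ^ (m - 1 - 1)) := by
  rw [pd_sig, Derivation.leibniz, Derivation.leibniz_pow, pd_z_self, Derivation.map_natCast]
  simp

theorem ratMap_sig (m : ℕ) : ratMap N (sig N m) = ∑ j, z j ^ m := by simp [sig, psum, z]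

theorem sig_isSymmetric (m : ℕ) : (sig N m).IsSymmetric := psum_isSymmetric _ _ _

theorem tau_isSymmetric (m : ℕ) : (tau N m).IsSymmetric := esymm_isSymmetric _ _ _

theorem ratMap_tau_top : ratMap N (tau N N) = ∏ i, z i := by
  have h : Finset.powersetCard N (Finset.univ : Finset (Fin N)) = {Finset.univ} := by
    simpa using Finset.powersetCard_self (Finset.univ : Finset (Fin N))
  simp [tau, esymm, h, z]

theorem ratMap_prod_erase (j : Fin N) :
    ratMap N (∏ i ∈ Finset.univ.erase j, X i) = ratMap N (tau N N) * (z j)⁻¹ := by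
  rw [ratMap_tau_top, ← Finset.mul_prod_erase _ _ (Finset.mem_univ j), map_prod]
  change (∏ i ∈ Finset.univ.erase j, z i) = _
  have := z_ne_zero j
  field_simp

theorem pd_tau_top (i : Fin N) : pd i (ratMap N (tau N N)) = ratMap N (tau N N) * (z i)⁻¹ := by
  have h : pd i (ratMap N (∏ j ∈ Finset.univ.erase i, X j)) = 0 := by
    rw [pd_algebraMap, pderiv_eq_zero_of_notMem_vars, map_zero]
    intro hi
    have := vars_prod (fun j => (X j : Poly N)) hi
    simp at this
  have h0 := z_ne_zero i
  -- The polynomial τ_N is linear in z_i, with a cofactor free of z_i.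
  have e : ratMap N (tau N N) = z i * ratMap N (∏ j ∈ Finset.univ.erase i, X j) := by
    rw [ratMap_prod_erase]
    field_simp
  rw [e, Derivation.leibniz, h, pd_z_self]
  simp only [smul_eq_mul]
  field_simp
  ring

theorem pd_pd_tau_top (i : Fin N) : pd i (pd i (ratMap N (tau N N))) = 0 := by
  rw [pd_tau_top, Derivation.leibniz, pd_tau_top, pd_z_inv, if_pos rfl]
  simp only [smul_eq_mul]
  ring

theorem gam_one_tau_top (x : RatFun N) :
    gam 1 (ratMap N (tau N N)) x = ratMap N (tau N N) * ∑ i, pd i x := by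
  simp only [gam_apply, pd_tau_top, Finset.mul_sum]
  refine Finset.sum_congr rfl fun i _ => ?_
  have := z_ne_zero i
  rw [Fin.val_one]
  field_simp

theorem gam_two_tau_top (x : RatFun N) :
    gam 2 (ratMap N (tau N N)) x = ratMap N (tau N N) * ∑ i, z i * pd i x := by
  simp only [gam_apply, pd_tau_top, Finset.mul_sum]
  refine Finset.sum_congr rfl fun i _ => ?_
  have := z_ne_zero i
  simp
  field_simp

theorem gam_sig_sig (ε : Fin 3) (l m : ℕ) :
    gam ε (ratMap N (sig N l)) (ratMap N (sig N m)) =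
      (l : RatFun N) * (m : RatFun N) * ∑ i : Fin N, z i ^ ((ε : ℕ) + (l - 1) + (m - 1)) := by
  simp only [gam_apply, pd_sig, Finset.mul_sum, pow_add]
  exact Finset.sum_congr rfl fun i _ => by ring

section

variable [NeZero N]

/-- The contribution to `T_ε z_j` of each of the two pairs of neighbours containing `j`. -/
def linVal (ε : Fin 3) (x : RatFun N) : RatFun N :=
  match ε with
  | 0 => 0
  | 1 => 1 / 2
  | 2 => x

/-- Both parts combine to (z_j^ε - ϑ_ε)/(z_j - z'), where z' is the neighbour in the pair. The
choice of ϑ_ε makes this quotient independent of z'. -/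
theorem pairTerm_z (hN : 2 ≤ N) (ε : Fin 3) (i j : Fin N) :
    pairTerm ε i (z j) = if j = i ∨ j = i + 1 then linVal ε (z j) else 0 := by
  have hne := add_one_ne_self hN i
  have hz := z_sub_ne_zero hne.symm
  split_ifs with h
  · rcases h with rfl | rfl
    · simp only [pairTerm, pd_z_self, pd_z_of_ne hne.symm, permVar_swap_z_left]
      fin_cases ε <;> simp [theta, linVal] <;> field_simp <;> ring
    · simp only [pairTerm, pd_z_self, pd_z_of_ne hne, permVar_swap_z_right]
      fin_cases ε <;> simp [theta, linVal] <;> field_simp <;> ring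
  · push Not at h
    exact pairTerm_of_const _ _ (pd_z_of_ne h.1) (pd_z_of_ne h.2) (permVar_swap_z_of_ne h.1 h.2)

/-- The pairs containing j are those starting at j and at j - 1. They have distinct indices even for
N = 2, where the same two particles are counted twice. -/
theorem sum_ite_neighbour (hN : 2 ≤ N) (j : Fin N) (c : RatFun N) :
    ∑ i : Fin N, (if j = i ∨ j = i + 1 then c else 0) = 2 * c := by
  have h (i : Fin N) : (if j = i ∨ j = i + 1 then c else 0) =
      (if j = i then c else 0) + (if j - 1 = i then c else 0) := by
    have e : j = i + 1 ↔ j - 1 = i := sub_eq_iff_eq_add.symm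
    by_cases h1 : j = i
    · have : ¬ j - 1 = i := by
        rw [← e, h1]
        exact (add_one_ne_self hN i).symm
      rw [if_pos (Or.inl h1), if_pos h1, if_neg this, add_zero]
    · simp only [h1, false_or, e, if_false, zero_add]
  simp only [h, Finset.sum_add_distrib, Finset.sum_ite_eq, Finset.mem_univ, if_true, two_mul]

theorem TScalar_z (hN : 2 ≤ N) (ε : Fin 3) (a : ℝ) (j : Fin N) :
    TScalar ε a (z j) = (2 * a : ℂ) • (2 * linVal ε (z j)) := by
  simp only [TScalar_apply, pd_pd_z, pairTerm_z hN, sum_ite_neighbour hN, mul_zero,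
    Finset.sum_const_zero, zero_add]

theorem z_sub_permVar_mul_self (hN : 2 ≤ N) (i j : Fin N) :
    (z j - permVar (Equiv.swap i (i + 1)) (z j)) * (z j - permVar (Equiv.swap i (i + 1)) (z j)) /
        (z i - z (i + 1)) ^ 2 = if j = i ∨ j = i + 1 then (1 : RatFun N) else 0 := by
  have hz := z_sub_ne_zero (add_one_ne_self hN i).symm
  split_ifs with h
  · rcases h with rfl | rfl
    · rw [permVar_swap_z_left]
      field_simp
    · rw [permVar_swap_z_right]
      field_simp
      ring
  · push Not at h
    rw [permVar_swap_z_of_ne h.1 h.2]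
    simp

/-- Only an exchange that moves both variables contributes, that is, the exchange of j and l
themselves; the two differences are then opposite. This is where adjacency in the cycle enters. -/
theorem z_sub_permVar_mul (hN : 2 ≤ N) (i : Fin N) {j l : Fin N} (hjl : j ≠ l) :
    (z j - permVar (Equiv.swap i (i + 1)) (z j)) * (z l - permVar (Equiv.swap i (i + 1)) (z l)) /
        (z i - z (i + 1)) ^ 2 =
      if (j = i ∧ l = i + 1) ∨ (j = i + 1 ∧ l = i) then (-1 : RatFun N) else 0 := by
  have hz := z_sub_ne_zero (add_one_ne_self hN i).symm
  split_ifs with h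
  · rcases h with ⟨rfl, rfl⟩ | ⟨rfl, rfl⟩
    · rw [permVar_swap_z_left, permVar_swap_z_right]
      field_simp
      ring
    · rw [permVar_swap_z_left, permVar_swap_z_right]
      field_simp
      ring
  · push Not at h
    by_cases h1 : j = i
    · subst h1
      rw [permVar_swap_z_of_ne hjl.symm (h.1 rfl)]
      simp
    by_cases h2 : j = i + 1
    · subst h2
      rw [permVar_swap_z_of_ne (h.2 rfl) hjl.symm]
      simp
    rw [permVar_swap_z_of_ne h1 h2]
    simp

theorem TScalar_zero_z_sq (hN : 2 ≤ N) (a : ℝ) (j : Fin N) :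
    TScalar 0 a (z j ^ 2) = (2 + 4 * a : ℂ) • (1 : RatFun N) := by
  have h (i : Fin N) : theta 0 (z i) (z (i + 1)) / (z i - z (i + 1)) ^ 2 *
      ((z j - permVar (Equiv.swap i (i + 1)) (z j)) *
        (z j - permVar (Equiv.swap i (i + 1)) (z j))) =
      if j = i ∨ j = i + 1 then (1 : RatFun N) else 0 := by
    rw [← z_sub_permVar_mul_self hN, theta]
    ring
  rw [sq, TScalar_mul, TScalar_z hN, gam_z, pd_z_self]
  simp only [h, sum_ite_neighbour hN, linVal]
  have e : (2 : RatFun N) = (2 : ℂ) • (1 : RatFun N) := by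
    rw [Algebra.smul_def, mul_one]; exact (map_ofNat _ 2).symm
  simp only [Fin.coe_ofNat_eq_mod, Nat.zero_mod, pow_zero, mul_one, mul_zero, smul_zero, zero_mul,
    zero_add]
  rw [e, smul_smul, ← add_smul]
  congr 1
  ring

theorem TScalar_z_mul_z (hN : 2 ≤ N) (ε : Fin 3) (a : ℝ) {j l : Fin N} (hjl : j ≠ l) :
    TScalar ε a (z j * z l) = (2 * a : ℂ) • (2 * (linVal ε (z j) * z l + z j * linVal ε (z l)) +
      ∑ i, if (j = i ∧ l = i + 1) ∨ (j = i + 1 ∧ l = i) then -theta ε (z i) (z (i + 1)) else 0)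
      := by
  have h (i : Fin N) : theta ε (z i) (z (i + 1)) / (z i - z (i + 1)) ^ 2 *
      ((z j - permVar (Equiv.swap i (i + 1)) (z j)) *
        (z l - permVar (Equiv.swap i (i + 1)) (z l))) =
      if (j = i ∧ l = i + 1) ∨ (j = i + 1 ∧ l = i) then -theta ε (z i) (z (i + 1)) else 0 := by
    have h1 := z_sub_permVar_mul hN i hjl
    rw [div_mul_eq_mul_div, mul_div_assoc, h1]
    split_ifs <;> simp
  rw [TScalar_mul, gam_z_z_of_ne ε hjl, TScalar_z hN, TScalar_z hN]
  simp only [h, smul_add, mul_smul_comm, smul_mul_assoc, mul_zero, add_zero, mul_add]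
  congr 1
  rw [add_comm]
  congr 2 <;> ring

/-- For ε = 2 the derivative and difference parts of every pair cancel on 1/z_j, which leaves z_j²
∂_j²(1/z_j). -/
theorem TScalar_two_z_inv (hN : 2 ≤ N) (a : ℝ) (j : Fin N) :
    TScalar 2 a (z j)⁻¹ = 2 * (z j)⁻¹ := by
  have h (i : Fin N) : pairTerm 2 i (z j)⁻¹ = 0 := by
    have hne := add_one_ne_self hN i
    have hz := z_sub_ne_zero hne.symm
    have h0 := z_ne_zero i
    have h1 := z_ne_zero (i + 1)
    by_cases e1 : j = i
    · subst e1
      simp only [pairTerm, pd_z_inv, hne.symm, if_true, if_false, map_inv₀, permVar_swap_z_left,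
        theta]
      simp
      field_simp
      ring
    by_cases e2 : j = i + 1
    · subst e2
      simp only [pairTerm, pd_z_inv, hne, if_true, if_false, map_inv₀, permVar_swap_z_right,
        theta]
      simp
      field_simp
      ring
    exact pairTerm_of_const _ _ (by simp [pd_z_inv, e1]) (by simp [pd_z_inv, e2])
      (by rw [map_inv₀, permVar_swap_z_of_ne e1 e2])
  simp only [TScalar_apply, h, Finset.sum_const_zero, smul_zero, add_zero]
  rw [Finset.sum_eq_single j]
  · have h0 := z_ne_zero j
    simp [pd_z_inv, Derivation.leibniz_pow, -inv_pow]
    field_simp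
  · intro i _ hi
    simp [pd_z_inv, hi.symm]
  · simp

/-! ### Values on the symmetric polynomials -/

theorem sum_shift (f : Fin N → RatFun N) : ∑ i, f (i + 1) = ∑ i, f i :=
  Equiv.sum_comp (Equiv.addRight (1 : Fin N)) f

theorem TScalar_of_isSymmetric (ε : Fin 3) (a : ℝ) {p : Poly N} (hp : p.IsSymmetric) :
    TScalar ε a (ratMap N p) = ∑ i, z i ^ (ε : ℕ) * pd i (pd i (ratMap N p)) +
      (2 * a : ℂ) • ∑ i, (z i ^ (ε : ℕ) * pd i (ratMap N p) -
        z (i + 1) ^ (ε : ℕ) * pd (i + 1) (ratMap N p)) / (z i - z (i + 1)) := by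
  simp only [TScalar_apply, pairTerm, permVar_ratMap_of_isSymmetric _ hp, sub_self, mul_zero,
    sub_zero, one_div_mul_eq_div]

/-- Here `e i` is the divided difference of z^ε ∂p over a neighbouring pair. Supplying it explicitly
removes all denominators from the evaluations below. -/
theorem TScalar_eq_of_isSymmetric (ε : Fin 3) (a : ℝ) {p : Poly N} (hp : p.IsSymmetric)
    (d e : Fin N → RatFun N) (hd : ∀ i, z i ^ (ε : ℕ) * pd i (pd i (ratMap N p)) = d i)
    (he : ∀ i, z i ^ (ε : ℕ) * pd i (ratMap N p) -
      z (i + 1) ^ (ε : ℕ) * pd (i + 1) (ratMap N p) = e i * (z i - z (i + 1))) (hN : 2 ≤ N) :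
    TScalar ε a (ratMap N p) = ∑ i, d i + (2 * a : ℂ) • ∑ i, e i := by
  rw [TScalar_of_isSymmetric ε a hp]
  simp only [hd, he]
  simp only [mul_div_cancel_right₀ _ (z_sub_ne_zero (add_one_ne_self hN _).symm)]

theorem TScalar_zero_sig_one (hN : 2 ≤ N) (a : ℝ) : TScalar 0 a (ratMap N (sig N 1)) = 0 := by
  rw [TScalar_eq_of_isSymmetric 0 a (sig_isSymmetric 1) (fun _ => 0) (fun _ => 0) ?_ ?_ hN]
  · simp
  · intro i; rw [pd_pd_sig]; simp
  · intro i; rw [pd_sig, pd_sig]; simp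

theorem TScalar_zero_sig_two (hN : 2 ≤ N) (a : ℝ) :
    TScalar 0 a (ratMap N (sig N 2)) = (N * (2 + 4 * a) : ℂ) • (1 : RatFun N) := by
  rw [TScalar_eq_of_isSymmetric 0 a (sig_isSymmetric 2) (fun _ => 2) (fun _ => 2) ?_ ?_ hN]
  · simp only [Finset.sum_const, Finset.card_univ, Fintype.card_fin, eq_natCast,
      Algebra.smul_def, map_add, map_mul, map_natCast, map_ofNat]
    ring
  · intro i; rw [pd_pd_sig]; simp
  · intro i; rw [pd_sig, pd_sig]; simp; ring

theorem TScalar_zero_sig_three (hN : 2 ≤ N) (a : ℝ) :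
    TScalar 0 a (ratMap N (sig N 3)) = (6 + 12 * a : ℂ) • ratMap N (sig N 1) := by
  rw [TScalar_eq_of_isSymmetric 0 a (sig_isSymmetric 3) (fun i => 6 * z i)
    (fun i => 3 * z i + 3 * z (i + 1)) ?_ ?_ hN, ratMap_sig]
  · simp only [Finset.sum_add_distrib, sum_shift fun i => 3 * z i, ← Finset.mul_sum, pow_one,
      Algebra.smul_def, map_add, map_mul, map_ofNat]
    ring
  · intro i; rw [pd_pd_sig]; simp; ring
  · intro i; rw [pd_sig, pd_sig]; simp; ring

theorem TScalar_one_sig_one (hN : 2 ≤ N) (a : ℝ) :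
    TScalar 1 a (ratMap N (sig N 1)) = (2 * a * N : ℂ) • (1 : RatFun N) := by
  rw [TScalar_eq_of_isSymmetric 1 a (sig_isSymmetric 1) (fun _ => 0) (fun _ => 1) ?_ ?_ hN]
  · simp only [Finset.sum_const, Finset.card_univ, Fintype.card_fin, eq_natCast,
      Algebra.smul_def, map_mul, map_natCast, map_ofNat]
    ring
  · intro i; rw [pd_pd_sig]; simp
  · intro i; rw [pd_sig, pd_sig]; simp

theorem TScalar_one_sig_two (hN : 2 ≤ N) (a : ℝ) :
    TScalar 1 a (ratMap N (sig N 2)) = (2 + 8 * a : ℂ) • ratMap N (sig N 1) := by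
  rw [TScalar_eq_of_isSymmetric 1 a (sig_isSymmetric 2) (fun i => 2 * z i)
    (fun i => 2 * z i + 2 * z (i + 1)) ?_ ?_ hN, ratMap_sig]
  · simp only [Finset.sum_add_distrib, sum_shift fun i => 2 * z i, ← Finset.mul_sum, pow_one,
      Algebra.smul_def, map_add, map_mul, map_ofNat]
    ring
  · intro i; rw [pd_pd_sig]; simp; ring
  · intro i; rw [pd_sig, pd_sig]; simp; ring

theorem TScalar_two_sig_one (hN : 2 ≤ N) (a : ℝ) :
    TScalar 2 a (ratMap N (sig N 1)) = (4 * a : ℂ) • ratMap N (sig N 1) := by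
  rw [TScalar_eq_of_isSymmetric 2 a (sig_isSymmetric 1) (fun _ => 0)
    (fun i => z i + z (i + 1)) ?_ ?_ hN, ratMap_sig]
  · simp only [Finset.sum_add_distrib, sum_shift fun i => z i, Finset.sum_const_zero, pow_one,
      Algebra.smul_def, map_mul, map_ofNat]
    ring
  · intro i; rw [pd_pd_sig]; simp
  · intro i; rw [pd_sig, pd_sig]; simp; ring

theorem tau_pred : tau N (N - 1) = ∑ j, ∏ i ∈ Finset.univ.erase j, X i := by
  rw [tau, esymm]
  symm
  refine Finset.sum_bij (fun j _ => Finset.univ.erase j) ?_ ?_ ?_ fun _ _ => rfl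
  · intro j _
    simp [Finset.mem_powersetCard]
  · intro j _ l _ h
    by_contra hne
    have : j ∈ Finset.univ.erase j := by
      rw [h]
      simp [hne]
    simp at this
  · intro t ht
    -- A set of N - 1 indices is the complement of a single index.
    have hcard : tᶜ.card = 1 := by
      rw [Finset.card_compl, (Finset.mem_powersetCard.mp ht).2, Fintype.card_fin]
      have := NeZero.pos N
      omega
    obtain ⟨j, hj⟩ := Finset.card_eq_one.mp hcard
    refine ⟨j, Finset.mem_univ _, ?_⟩
    rw [← compl_compl t, hj]
    ext; simp

theorem ratMap_tau_pred :
    ratMap N (tau N (N - 1)) = ratMap N (tau N N) * ∑ j, (z j)⁻¹ := by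
  rw [tau_pred, map_sum, Finset.mul_sum]
  exact Finset.sum_congr rfl fun j _ => ratMap_prod_erase j

theorem pd_tau_pred (i : Fin N) : pd i (ratMap N (tau N (N - 1))) =
    (z i)⁻¹ * ratMap N (tau N (N - 1)) - (z i)⁻¹ ^ 2 * ratMap N (tau N N) := by
  have h : pd i (∑ j, (z j)⁻¹ : RatFun N) = -(z i)⁻¹ ^ 2 := by
    rw [map_sum, Finset.sum_eq_single i]
    · simp [pd_z_inv]
    · intro j _ hj
      simp [pd_z_inv, hj]
    · simp
  rw [ratMap_tau_pred, Derivation.leibniz, h, pd_tau_top]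
  simp only [smul_eq_mul]
  ring

theorem pd_pd_tau_pred (i : Fin N) : pd i (pd i (ratMap N (tau N (N - 1)))) = 0 := by
  rw [pd_tau_pred, map_sub, Derivation.leibniz, Derivation.leibniz, pd_tau_pred, pd_tau_top,
    Derivation.leibniz_pow, pd_z_inv, if_pos rfl]
  simp only [smul_eq_mul, nsmul_eq_mul, Nat.cast_ofNat]
  ring

theorem TScalar_one_tau_top (hN : 2 ≤ N) (a : ℝ) : TScalar 1 a (ratMap N (tau N N)) = 0 := by
  have h (i : Fin N) : z i ^ ((1 : Fin 3) : ℕ) * pd i (ratMap N (tau N N)) =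
      ratMap N (tau N N) := by
    have := z_ne_zero i
    rw [pd_tau_top, Fin.val_one]
    field_simp
  rw [TScalar_eq_of_isSymmetric 1 a (tau_isSymmetric N) (fun _ => 0) (fun _ => 0) ?_ ?_ hN]
  · simp
  · intro i; rw [pd_pd_tau_top, mul_zero]
  · intro i; rw [h, h]; ring

theorem TScalar_two_tau_top (hN : 2 ≤ N) (a : ℝ) :
    TScalar 2 a (ratMap N (tau N N)) = (2 * a * N : ℂ) • ratMap N (tau N N) := by
  have h (i : Fin N) : z i ^ ((2 : Fin 3) : ℕ) * pd i (ratMap N (tau N N)) =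
      z i * ratMap N (tau N N) := by
    have := z_ne_zero i
    rw [pd_tau_top, Fin.val_two]
    field_simp
  rw [TScalar_eq_of_isSymmetric 2 a (tau_isSymmetric N) (fun _ => 0)
    (fun _ => ratMap N (tau N N)) ?_ ?_ hN]
  · simp only [Finset.sum_const, Finset.card_univ, Fintype.card_fin, eq_natCast, mul_zero,
      Algebra.smul_def, map_mul, map_natCast, map_ofNat]
    ring
  · intro i; rw [pd_pd_tau_top, mul_zero]
  · intro i; rw [h, h]; ring

theorem TScalar_two_tau_pred (hN : 2 ≤ N) (a : ℝ) :
    TScalar 2 a (ratMap N (tau N (N - 1))) = (2 * a * N : ℂ) • ratMap N (tau N (N - 1)) := by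
  have h (i : Fin N) : z i ^ ((2 : Fin 3) : ℕ) * pd i (ratMap N (tau N (N - 1))) =
      z i * ratMap N (tau N (N - 1)) - ratMap N (tau N N) := by
    have := z_ne_zero i
    rw [pd_tau_pred, Fin.val_two]
    field_simp
  rw [TScalar_eq_of_isSymmetric 2 a (tau_isSymmetric (N - 1)) (fun _ => 0)
    (fun _ => ratMap N (tau N (N - 1))) ?_ ?_ hN]
  · simp only [Finset.sum_const, Finset.card_univ, Fintype.card_fin, eq_natCast, mul_zero,
      Algebra.smul_def, map_mul, map_natCast, map_ofNat]
    ring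
  · intro i; rw [pd_pd_tau_pred, mul_zero]
  · intro i; rw [h, h]; ring

theorem gam_two_tau_pred (x : RatFun N) :
    gam 2 (ratMap N (tau N (N - 1))) x =
      ratMap N (tau N (N - 1)) * ∑ i, z i * pd i x - ratMap N (tau N N) * ∑ i, pd i x := by
  simp only [gam_apply, pd_tau_pred, Finset.mul_sum, ← Finset.sum_sub_distrib]
  refine Finset.sum_congr rfl fun i _ => ?_
  have := z_ne_zero i
  simp
  field_simp

end

end

noncomputable section

variable {N k : ℕ}

/-! ### Vector-valued functions -/

theorem ket_add (f g : RatFun N) (v : Spin N k) : ket (f + g) v = ket f v + ket g v :=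
  funext fun _ => smul_add _ _ _

theorem ket_sub (f g : RatFun N) (v : Spin N k) : ket (f - g) v = ket f v - ket g v :=
  funext fun _ => smul_sub _ _ _

theorem ket_smul (c : ℂ) (f : RatFun N) (v : Spin N k) : ket (c • f) v = c • ket f v :=
  funext fun _ => smul_comm _ _ _

theorem ket_zero (v : Spin N k) : ket (0 : RatFun N) v = 0 := by
  funext s; simp [ket]

theorem poly_smul_apply (p : Poly N) (Ψ : State N k) (s : Config N k) :
    (p • Ψ) s = ratMap N p * Ψ s := by
  rw [Pi.smul_apply, Algebra.smul_def]

theorem ket_ratMap_mul (p : Poly N) (f : RatFun N) (v : Spin N k) :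
    ket (ratMap N p * f) v = p • ket f v := by
  funext s
  rw [poly_smul_apply]
  simp [ket]

theorem Lam_apply (Ψ : State N k) :
    Lam Ψ = ((N ! : ℂ)⁻¹) • ∑ π : Equiv.Perm (Fin N), permState π Ψ := by
  simp [Lam]

theorem Lam_ket (f : RatFun N) (v : Spin N k) :
    Lam (ket f v) =
      ((N ! : ℂ)⁻¹) • ∑ π : Equiv.Perm (Fin N), ket (permVar π f) (permSpin π v) := by
  simp only [Lam_apply, permState_ket]

theorem permVar_mul (π ρ : Equiv.Perm (Fin N)) (f : RatFun N) :
    permVar π (permVar ρ f) = permVar (π * ρ) f := by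
  have hpoly (p : Poly N) : permVar π (permVar ρ (ratMap N p)) = permVar (π * ρ) (ratMap N p) := by
    rw [permVar_ratMap, permVar_ratMap, permVar_ratMap, rename_rename]
    rfl
  obtain ⟨p, q, hq, rfl⟩ := exists_eq_div (A := Poly N) f
  simp only [map_div₀, hpoly]

/-- Right translation by `ρ` reindexes the average. This allows a seed to be relabelled at the cost
of permuting its spin vector. -/
theorem Lam_permState (ρ : Equiv.Perm (Fin N)) (Ψ : State N k) :
    Lam (permState ρ Ψ) = Lam Ψ := by
  rw [Lam_apply, Lam_apply, ← Equiv.sum_comp (Equiv.mulRight ρ) fun π => permState π Ψ]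
  congr 1
  refine Finset.sum_congr rfl fun π _ => ?_
  funext s
  simp only [permState, LinearMap.coe_mk, AddHom.coe_mk, permVar_mul, Equiv.coe_mulRight,
    Equiv.Perm.coe_mul, Function.comp_assoc]

theorem permState_smul_of_isSymmetric (π : Equiv.Perm (Fin N)) {p : Poly N} (hp : p.IsSymmetric)
    (Ψ : State N k) : permState π (p • Ψ) = p • permState π Ψ := by
  funext s
  simp only [permState, LinearMap.coe_mk, AddHom.coe_mk, poly_smul_apply, map_mul]
  rw [permVar_ratMap_of_isSymmetric π hp]

theorem Lam_smul_of_isSymmetric {p : Poly N} (hp : p.IsSymmetric) (Ψ : State N k) :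
    Lam (p • Ψ) = p • Lam Ψ := by
  simp only [Lam_apply, permState_smul_of_isSymmetric _ hp, ← Finset.smul_sum]
  rw [smul_comm]

theorem Lam_ket_ratMap_mul {p : Poly N} (hp : p.IsSymmetric) (f : RatFun N) (v : Spin N k) :
    Lam (ket (ratMap N p * f) v) = p • Lam (ket f v) := by
  rw [ket_ratMap_mul, Lam_smul_of_isSymmetric hp]

theorem Lam_ket_smul (c : ℂ) (f : RatFun N) (v : Spin N k) :
    Lam (ket (c • f) v) = c • Lam (ket f v) := by
  rw [ket_smul, map_smul]

theorem Lam_ket_of_isSymm {v : Spin N k} (hv : IsSymmSpin v) : Lam (ket 1 v) = ket 1 v := by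
  rw [Lam_ket]
  simp only [map_one, hv _, Finset.sum_const, Finset.card_univ, Fintype.card_perm,
    Fintype.card_fin, ← Nat.cast_smul_eq_nsmul ℂ, smul_smul]
  rw [inv_mul_cancel₀ (Nat.cast_ne_zero.mpr N.factorial_ne_zero), one_smul]

/-- The operator `Ψ ↦ ∑ z_i^ε ∂_i f ∂_i Ψ`. -/
def gamState (ε : Fin 3) (f : RatFun N) : State N k →ₗ[ℂ] State N k :=
  (gam ε f : RatFun N →ₗ[ℂ] RatFun N).compLeft (Config N k)

theorem gamState_ket (ε : Fin 3) (f g : RatFun N) (v : Spin N k) :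
    gamState ε f (ket g v) = ket (gam ε f g) v := by
  funext s
  simp [gamState, ket]

/-- The form Γ_ε is equivariant under permutations and `p` is fixed by them, so Γ_ε(p, ·) commutes
with Λ. -/
theorem gamState_Lam_ket (ε : Fin 3) {p : Poly N} (hp : p.IsSymmetric) (f : RatFun N)
    (v : Spin N k) :
    gamState ε (ratMap N p) (Lam (ket f v)) = Lam (ket (gam ε (ratMap N p) f) v) := by
  rw [Lam_ket, Lam_ket, map_smul, map_sum]
  congr 1
  refine Finset.sum_congr rfl fun π _ => ?_
  rw [gamState_ket, permVar_gam, permVar_ratMap_of_isSymmetric π hp]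

variable [NeZero N]

theorem T_apply (ε : Fin 3) (a : ℝ) (Ψ : State N k) (s : Config N k) :
    T ε a Ψ s = TScalar ε a (Ψ s) := rfl

theorem T_ket (ε : Fin 3) (a : ℝ) (f : RatFun N) (v : Spin N k) :
    T ε a (ket f v) = ket (TScalar ε a f) v := by
  funext s
  simp [T_apply, ket]

/-- The substitute for commutation with Λ: it suffices that the image of the seed is given by the
same formula for every relabelling of the variables. -/
theorem T_Lam_ket (ε : Fin 3) (a : ℝ) {f g : RatFun N}
    (h : ∀ π, TScalar ε a (permVar π f) = permVar π g) (v : Spin N k) :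
    T ε a (Lam (ket f v)) = Lam (ket g v) := by
  rw [Lam_ket, Lam_ket, map_smul, map_sum]
  simp only [T_ket, h]

/-- The product rule for symmetric coefficients, applied coordinatewise. It splits the proof of
invariance into the action on the seed, the action on the coefficient and the cross terms. -/
theorem T_subst_smul {r : ℕ} (ε : Fin 3) (a : ℝ) {u : Fin r → Poly N}
    (hu : ∀ i, (u i).IsSymmetric) (F : MvPolynomial (Fin r) ℂ) (f : RatFun N) (v : Spin N k) :
    T ε a (subst u F • Lam (ket f v)) = subst u F • T ε a (Lam (ket f v)) +
      TScalar ε a (ratMap N (subst u F)) • Lam (ket f v) +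
      (2 : ℂ) • ∑ l, subst u (pderiv l F) • Lam (ket (gam ε (ratMap N (u l)) f) v) := by
  simp only [← gamState_Lam_ket ε (hu _)]
  funext s
  have h2 (x : RatFun N) : (2 : ℂ) • x = 2 * x := by
    rw [Algebra.smul_def]; congr 1; exact map_ofNat _ 2
  rw [T_apply, poly_smul_apply, TScalar_mul_of_symm ε a (fun π =>
    permVar_ratMap_of_isSymmetric π (subst_isSymmetric hu F)), gam_subst_left]
  simp only [Pi.add_apply, poly_smul_apply, T_apply]
  rw [Pi.smul_apply, Pi.smul_apply, smul_eq_mul, h2, Finset.sum_apply]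
  simp only [poly_smul_apply]
  rfl

/-! ### The arguments of the coefficient polynomials -/

/-- The three symmetric polynomials that enter the generators of `𝒯_ε`. -/
def args (N : ℕ) (ε : Fin 3) : Fin 3 → Poly N :=
  match ε with
  | 0 => ![sig N 1, sig N 2, sig N 3]
  | 1 => ![sig N 1, sig N 2, tau N N]
  | 2 => ![sig N 1, tau N (N - 1), tau N N]

/-- The degrees of the polynomials `args N ε`. -/
def argDeg (N : ℕ) (ε : Fin 3) : Fin 3 → ℕ :=
  match ε with
  | 0 => ![1, 2, 3]
  | 1 => ![1, 2, N]
  | 2 => ![1, N - 1, N]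

omit [NeZero N] in
theorem args_isSymmetric (ε i : Fin 3) : (args N ε i).IsSymmetric :=
  match ε, i with
  | 0, 0 | 0, 1 | 0, 2 | 1, 0 | 1, 1 | 2, 0 => sig_isSymmetric _
  | 1, 2 | 2, 2 => tau_isSymmetric N
  | 2, 1 => (tau_isSymmetric (N - 1) : (tau N (N - 1)).IsSymmetric)

omit [NeZero N] in
theorem sig_isHomogeneous (m : ℕ) : (sig N m).IsHomogeneous m :=
  IsHomogeneous.sum _ _ _ fun i _ => isHomogeneous_X_pow i m

omit [NeZero N] in
theorem tau_isHomogeneous (m : ℕ) : (tau N m).IsHomogeneous m := by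
  refine IsHomogeneous.sum _ _ _ fun t ht => ?_
  have h := IsHomogeneous.prod t (fun i => (X i : Poly N)) (fun _ => 1)
    fun i _ => isHomogeneous_X ℂ i
  rwa [Finset.sum_const, smul_eq_mul, mul_one, (Finset.mem_powersetCard.mp ht).2] at h

omit [NeZero N] in
theorem args_isHomogeneous (ε i : Fin 3) : (args N ε i).IsHomogeneous (argDeg N ε i) :=
  match ε, i with
  | 0, 0 | 0, 1 | 0, 2 | 1, 0 | 1, 1 | 2, 0 => sig_isHomogeneous _
  | 1, 2 | 2, 2 => tau_isHomogeneous N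
  | 2, 1 => (tau_isHomogeneous (N - 1) : (tau N (N - 1)).IsHomogeneous (N - 1))

/-- The weight of the monomials in three formal variables. -/
abbrev wt (N : ℕ) (ε : Fin 3) : Fin 3 → ℤ := fun i => argDeg N ε i

/-- `i ↦ 1`, `j ↦ 0` for `j ≠ i`: the weight that records the exponent of the variable `i`. -/
abbrev expo (i : Fin 3) : Fin 3 → ℤ := Pi.single i 1

/-- The action of `T_ε` on polynomials in `args N ε`. -/
def formalT (N : ℕ) (ε : Fin 3) (a : ℝ) (F : MvPolynomial (Fin 3) ℂ) : MvPolynomial (Fin 3) ℂ :=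
  match ε with
  | 0 => (N * (2 + 4 * a) : ℂ) • pderiv 1 F + (6 + 12 * a : ℂ) • (X 0 * pderiv 2 F) +
      (N : ℂ) • pderiv 0 (pderiv 0 F) +
      (2 : ℂ) • (X 0 * (pderiv 0 (pderiv 1 F) + pderiv 1 (pderiv 0 F))) +
      (3 : ℂ) • (X 1 * (pderiv 0 (pderiv 2 F) + pderiv 2 (pderiv 0 F))) +
      (4 : ℂ) • (X 1 * pderiv 1 (pderiv 1 F)) +
      (6 : ℂ) • (X 2 * (pderiv 1 (pderiv 2 F) + pderiv 2 (pderiv 1 F)))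
  | 1 => (2 * a * N : ℂ) • pderiv 0 F + (2 + 8 * a : ℂ) • (X 0 * pderiv 1 F) +
      X 0 * pderiv 0 (pderiv 0 F) +
      (2 : ℂ) • (X 1 * (pderiv 0 (pderiv 1 F) + pderiv 1 (pderiv 0 F))) +
      (N : ℂ) • (X 2 * (pderiv 0 (pderiv 2 F) + pderiv 2 (pderiv 0 F))) +
      (2 : ℂ) • (X 0 * (X 2 * (pderiv 1 (pderiv 2 F) + pderiv 2 (pderiv 1 F))))
  | 2 => (4 * a : ℂ) • (X 0 * pderiv 0 F) + (2 * a * N : ℂ) • (X 1 * pderiv 1 F) +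
      (2 * a * N : ℂ) • (X 2 * pderiv 2 F) +
      X 0 * (X 1 * (pderiv 0 (pderiv 1 F) + pderiv 1 (pderiv 0 F))) +
      (-N : ℂ) • (X 2 * (pderiv 0 (pderiv 1 F) + pderiv 1 (pderiv 0 F))) +
      X 0 * (X 2 * (pderiv 0 (pderiv 2 F) + pderiv 2 (pderiv 0 F))) +
      (N - 1 : ℂ) • (X 1 * (X 2 * (pderiv 1 (pderiv 2 F) + pderiv 2 (pderiv 1 F)))) +
      (N : ℂ) • (X 2 * (X 2 * pderiv 2 (pderiv 2 F)))

/-- The substitution of polynomials, with values in the rational functions. -/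
def ratSubst {r : ℕ} (u : Fin r → Poly N) : MvPolynomial (Fin r) ℂ →ₐ[ℂ] RatFun N :=
  (IsScalarTower.toAlgHom ℂ (Poly N) (RatFun N)).comp (aeval u)

omit [NeZero N] in
theorem ratMap_subst {r : ℕ} (u : Fin r → Poly N) (F : MvPolynomial (Fin r) ℂ) :
    ratMap N (subst u F) = ratSubst u F := rfl

omit [NeZero N] in
theorem ratSubst_X {r : ℕ} (u : Fin r → Poly N) (i : Fin r) :
    ratSubst u (X i) = ratMap N (u i) := by
  rw [← ratMap_subst, subst, aeval_X]

omit [NeZero N] in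
theorem args_zero : args N 0 0 = sig N 1 ∧ args N 0 1 = sig N 2 ∧ args N 0 2 = sig N 3 :=
  ⟨rfl, rfl, rfl⟩

omit [NeZero N] in
theorem args_one : args N 1 0 = sig N 1 ∧ args N 1 1 = sig N 2 ∧ args N 1 2 = tau N N :=
  ⟨rfl, rfl, rfl⟩

omit [NeZero N] in
theorem args_two : args N 2 0 = sig N 1 ∧ args N 2 1 = tau N (N - 1) ∧ args N 2 2 = tau N N :=
  ⟨rfl, rfl, rfl⟩

/-- Since Γ_0(σ_l, σ_m) = lm σ_{l+m-2}, the only value outside the arguments is the σ_4 coming from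
Γ_0(σ_3, σ_3), and `h` removes it. -/
theorem TScalar_zero_args (hN : 2 ≤ N) (a : ℝ) {F : MvPolynomial (Fin 3) ℂ}
    (h : pd2 2 F = 0) :
    TScalar 0 a (ratMap N (subst (args N 0) F)) =
      ratMap N (subst (args N 0) (formalT N 0 a F)) := by
  rw [ratMap_subst _ (formalT N 0 a F), TScalar_subst 0 a (args_isSymmetric 0)]
  simp only [ratMap_subst, Fin.sum_univ_three, args_zero, TScalar_zero_sig_one hN,
    TScalar_zero_sig_two hN, TScalar_zero_sig_three hN, gam_sig_sig, h, formalT, map_add,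
    map_smul, map_mul, map_zero, ratSubst_X]
  simp only [ratMap_sig, Algebra.smul_def, map_mul, map_add, map_ofNat,
    map_natCast, mul_zero, zero_mul, add_zero, zero_add]
  norm_num
  ring

/-- The values that do not close are Γ_1(σ_2, σ_2), a multiple of σ_3, and Γ_1(τ_N, τ_N) =
τ_{N-1}τ_N; the two hypotheses on `F` remove them. -/
theorem TScalar_one_args (hN : 2 ≤ N) (a : ℝ) {F : MvPolynomial (Fin 3) ℂ}
    (h1 : pd2 1 F = 0) (h2 : pd2 2 F = 0) :
    TScalar 1 a (ratMap N (subst (args N 1) F)) =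
      ratMap N (subst (args N 1) (formalT N 1 a F)) := by
  rw [ratMap_subst _ (formalT N 1 a F), TScalar_subst 1 a (args_isSymmetric 1)]
  simp only [ratMap_subst, Fin.sum_univ_three, args_one, TScalar_one_sig_one hN,
    TScalar_one_sig_two hN, TScalar_one_tau_top hN, gam_sig_sig, gam_one_tau_top,
    gam_comm 1 (ratMap N (sig N _)) (ratMap N (tau N N)), pd_sig, h1, h2, formalT, map_add,
    map_smul, map_mul, map_zero, ratSubst_X]
  simp only [ratMap_sig, Algebra.smul_def, map_mul, map_add, map_ofNat,
    map_natCast, mul_zero, zero_mul, add_zero, ← Finset.mul_sum]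
  norm_num
  ring

/-- Here Γ_2(σ_1, σ_1) = σ_2 and Γ_2(τ_{N-1}, τ_{N-1}), which involves τ_{N-2}, are removed by the
hypotheses. The value Γ_2(τ_N, τ_N) = Nτ_N² is harmless, so τ_N may occur to any power. -/
theorem TScalar_two_args (hN : 2 ≤ N) (a : ℝ) {F : MvPolynomial (Fin 3) ℂ}
    (h0 : pd2 0 F = 0) (h1 : pd2 1 F = 0) :
    TScalar 2 a (ratMap N (subst (args N 2) F)) =
      ratMap N (subst (args N 2) (formalT N 2 a F)) := by
  -- Euler's identity (`e2`, `e3`, `e4`) and translation derivatives (`e1`, `e5`) of the arguments.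
  have e1 : ∑ i, pd i (ratMap N (sig N 1)) = N := by simp only [pd_sig]; simp
  have e2 : ∑ i, z i * pd i (ratMap N (sig N 1)) = ratMap N (sig N 1) := by
    simp only [pd_sig]; simp [z]
  have e5 : ∑ i, pd i (ratMap N (tau N N)) = ratMap N (tau N (N - 1)) := by
    simp only [pd_tau_top, ← Finset.mul_sum, ← ratMap_tau_pred]
  have e3 : ∑ i, z i * pd i (ratMap N (tau N N)) = N * ratMap N (tau N N) := by
    have h (i : Fin N) : z i * (ratMap N (tau N N) * (z i)⁻¹) = ratMap N (tau N N) := by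
      have := z_ne_zero i
      field_simp
    simp only [pd_tau_top, h, Finset.sum_const, Finset.card_univ, Fintype.card_fin, nsmul_eq_mul]
  have e4 : ∑ i, z i * pd i (ratMap N (tau N (N - 1))) =
      (N - 1) * ratMap N (tau N (N - 1)) := by
    have h (i : Fin N) : z i * ((z i)⁻¹ * ratMap N (tau N (N - 1)) -
        (z i)⁻¹ ^ 2 * ratMap N (tau N N)) =
        ratMap N (tau N (N - 1)) - ratMap N (tau N N) * (z i)⁻¹ := by
      have := z_ne_zero i
      field_simp
    simp only [pd_tau_pred, h, Finset.sum_sub_distrib, ← Finset.mul_sum, ← ratMap_tau_pred,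
      Finset.sum_const, Finset.card_univ, Fintype.card_fin, nsmul_eq_mul]
    ring
  rw [ratMap_subst _ (formalT N 2 a F), TScalar_subst 2 a (args_isSymmetric 2)]
  simp only [ratMap_subst, Fin.sum_univ_three, args_two, TScalar_two_sig_one hN,
    TScalar_two_tau_top hN, TScalar_two_tau_pred hN,
    gam_comm 2 (ratMap N (sig N 1)) (ratMap N (tau N N)),
    gam_comm 2 (ratMap N (sig N 1)) (ratMap N (tau N (N - 1))),
    gam_two_tau_top, gam_two_tau_pred,
    h0, h1, formalT, map_add, map_smul, map_mul, map_zero, ratSubst_X]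
  simp only [e1, e2, e3, e4, e5, Algebra.smul_def, map_mul, map_sub, map_neg, map_one,
    map_ofNat, map_natCast, zero_mul, add_zero, zero_add]
  ring

end

noncomputable section

variable {N k : ℕ}

/-! ### Formal weight bounds under the formal operator -/

/-- Multiplication by a variable adds its weight and differentiation subtracts it. The hypotheses
say that no term of `formalT` raises the weight; they hold for the degree and for the exponent of
σ_3. -/
theorem formalT_zero_weightLE {w : Fin 3 → ℤ} {c : ℤ} (a : ℝ) {F : MvPolynomial (Fin 3) ℂ}
    (hF : WeightLE w c F) (h0 : 0 ≤ w 0) (h1 : 0 ≤ w 1) (h02 : w 0 ≤ w 2)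
    (h12 : w 1 ≤ w 0 + w 2) : WeightLE w c (formalT N 0 a F) := by
  rw [formalT]
  repeat' first
    | with_reducible apply WeightLE.add
    | with_reducible apply WeightLE.smul
    | with_reducible apply WeightLE.X_mul
    | with_reducible apply WeightLE.pderiv
  all_goals exact hF.mono (by linarith)

theorem formalT_one_weightLE {w : Fin 3 → ℤ} {c : ℤ} (a : ℝ) {F : MvPolynomial (Fin 3) ℂ}
    (hF : WeightLE w c F) (h0 : 0 ≤ w 0) (h01 : w 0 ≤ w 1) :
    WeightLE w c (formalT N 1 a F) := by
  rw [formalT]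
  repeat' first
    | with_reducible apply WeightLE.add
    | with_reducible apply WeightLE.smul
    | with_reducible apply WeightLE.X_mul
    | with_reducible apply WeightLE.pderiv
  all_goals exact hF.mono (by linarith)

/-- Only the term with τ_N ∂_{σ_1}∂_{τ_{N-1}} changes the weight. The inequality is an equality for
the degree weight, and it also holds for the weight -1 on τ_N, so divisibility by τ_N survives. -/
theorem formalT_two_weightLE {w : Fin 3 → ℤ} {c : ℤ} (a : ℝ) {F : MvPolynomial (Fin 3) ℂ}
    (hF : WeightLE w c F) (h : w 2 ≤ w 0 + w 1) :
    WeightLE w c (formalT N 2 a F) := by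
  rw [formalT]
  repeat' first
    | with_reducible apply WeightLE.add
    | with_reducible apply WeightLE.smul
    | with_reducible apply WeightLE.X_mul
    | with_reducible apply WeightLE.pderiv
  all_goals exact hF.mono (by linarith)

/-- The derivative would have only monomials with a negative exponent. -/
theorem pderiv_eq_zero_of_weightLE {r : ℕ} {i : Fin r} {F : MvPolynomial (Fin r) ℂ}
    (h : WeightLE (Pi.single i 1) 0 F) : pderiv i F = 0 := by
  have h' : WeightLE (Pi.single i 1) (-1) (pderiv i F) := WeightLE.pderiv i (h.mono (by simp))
  refine h'.eq_zero (by norm_num) fun j => ?_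
  rw [Pi.single_apply]
  split_ifs <;> norm_num

theorem exists_rename_eq {r r' : ℕ} {e : Fin r → Fin r'} (he : Function.Injective e)
    (j : Fin r') (hj : ∀ i, i ≠ j → i ∈ Set.range e) {F : MvPolynomial (Fin r') ℂ}
    (h : WeightLE (Pi.single j 1) 0 F) : ∃ G, rename e G = F := by
  rw [weightLE_single_iff] at h
  refine exists_rename_eq_of_vars_subset_range F e he fun i hi => hj i ?_
  rintro rfl
  obtain ⟨m, hm, hi⟩ := (mem_vars_iff_mem_support i).mp hi
  have := h m (mem_support_iff.mp hm)
  have := Finsupp.mem_support_iff.mp hi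
  omega

theorem totalDegree_subst_args_le {ε : Fin 3} {F : MvPolynomial (Fin 3) ℂ} {c : ℤ} {d : ℕ}
    (hF : WeightLE (wt N ε) c F) (hc : c ≤ d) : (subst (args N ε) F).totalDegree ≤ d :=
  totalDegree_subst_le (args_isHomogeneous ε) hc hF

theorem eq_zero_of_weightLE_wt {ε : Fin 3} {F : MvPolynomial (Fin 3) ℂ} {c : ℤ}
    (hF : WeightLE (wt N ε) c F) (hc : c < 0) : F = 0 :=
  hF.eq_zero hc fun _ => Int.natCast_nonneg _

theorem exists_weightLE_args (ε : Fin 3) (f : MvPolynomial (Fin 3) ℂ) {n : ℕ}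
    (hn : (subst (args N ε) f).totalDegree ≤ n) :
    ∃ F : MvPolynomial (Fin 3) ℂ, subst (args N ε) F = subst (args N ε) f ∧
      WeightLE (wt N ε) n F ∧ ∀ i, pd2 i f = 0 → WeightLE (expo i) 1 F :=
  exists_weightLE (args_isHomogeneous ε) f hn

theorem subst_args_rename {r : ℕ} (ε : Fin 3) (e : Fin r → Fin 3) (f : MvPolynomial (Fin r) ℂ) :
    subst (args N ε) (rename e f) = subst (args N ε ∘ e) f := aeval_rename _ _ _

/-- Two-variable version of `exists_weightLE_args`, for the arguments selected by `e`. -/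
theorem exists_weightLE_args_rename (ε : Fin 3) {e : Fin 2 → Fin 3} (he : Function.Injective e)
    (f : MvPolynomial (Fin 2) ℂ) {n : ℕ} (hn : (subst (args N ε ∘ e) f).totalDegree ≤ n) :
    ∃ F : MvPolynomial (Fin 3) ℂ, subst (args N ε) F = subst (args N ε ∘ e) f ∧
      WeightLE (wt N ε) n F ∧ (∀ j, j ∉ Set.range e → WeightLE (expo j) 0 F) ∧
      ∀ i, pd2 i f = 0 → WeightLE (expo (e i)) 1 F := by
  obtain ⟨G, hG, hw, h1⟩ := exists_weightLE (u := args N ε ∘ e) (w := argDeg N ε ∘ e)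
    (fun i => args_isHomogeneous ε (e i)) f hn
  refine ⟨rename e G, by rw [subst_args_rename, hG], ?_, ?_, ?_⟩
  · exact (weightLE_rename_iff he _ _ _).mpr hw
  · intro j hj
    rw [weightLE_rename_iff he]
    have : expo j ∘ e = 0 := by
      funext i
      exact Pi.single_eq_of_ne (fun h => hj ⟨i, h⟩) _
    rw [this]
    intro m _
    simp
  · intro i hi
    rw [weightLE_rename_iff he]
    have : expo (e i) ∘ e = Pi.single i 1 := by
      funext l
      simp [Pi.single_apply, he.eq_iff]
    rw [this]
    exact h1 i hi

theorem exists_eq_subst_rename {ε : Fin 3} {e : Fin 2 → Fin 3} (he : Function.Injective e)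
    (j : Fin 3) (hj : ∀ i, i ≠ j → i ∈ Set.range e) {F : MvPolynomial (Fin 3) ℂ} {c : ℤ} {d : ℕ}
    (h : WeightLE (expo j) 0 F) (hw : WeightLE (wt N ε) c F) (hc : c ≤ d) :
    ∃ f, subst (args N ε) F = subst (args N ε ∘ e) f ∧
      (subst (args N ε ∘ e) f).totalDegree ≤ d ∧
      ∀ i, WeightLE (expo (e i)) 1 F → pd2 i f = 0 := by
  obtain ⟨G, rfl⟩ := exists_rename_eq he j hj h
  refine ⟨G, subst_args_rename _ _ _, ?_, fun i hi => ?_⟩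
  · rw [← subst_args_rename]
    exact totalDegree_subst_args_le hw hc
  · rw [weightLE_rename_iff he] at hi
    have : expo (e i) ∘ e = Pi.single i 1 := by
      funext l
      simp [Pi.single_apply, he.eq_iff]
    rw [this] at hi
    exact (pd2_eq_zero_iff i G).mpr hi

/-! ### Membership in the invariant spaces -/

theorem comp_args_zero : args N 0 ∘ ![0, 1] = ![sig N 1, sig N 2] := by
  funext i; fin_cases i <;> rfl

theorem comp_args_one : args N 1 ∘ ![0, 2] = ![sig N 1, tau N N] := by
  funext i; fin_cases i <;> rfl

theorem comp_args_two : args N 2 ∘ ![1, 2] = ![tau N (N - 1), tau N N] := by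
  funext i; fin_cases i <;> rfl

theorem comp_args_two' : args N 2 ∘ ![0, 2] = ![sig N 1, tau N N] := by
  funext i; fin_cases i <;> rfl

theorem args_zero_eq : args N 0 = ![sig N 1, sig N 2, sig N 3] := rfl

theorem args_one_eq : args N 1 = ![sig N 1, sig N 2, tau N N] := rfl

theorem args_two_eq : args N 2 = ![sig N 1, tau N (N - 1), tau N N] := rfl

theorem subst_zero_smul_mem {r : ℕ} (u : Fin r → Poly N) (Ψ : State N k)
    (V : Submodule ℂ (State N k)) : subst u 0 • Ψ ∈ V := by
  rw [subst, map_zero, zero_smul]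
  exact V.zero_mem

variable [NeZero N]

theorem mem_F_zero {n : ℕ} {c : ℤ} {F : MvPolynomial (Fin 3) ℂ} (hw : WeightLE (wt N 0) c F)
    (h2 : WeightLE (expo 2) 1 F) (hc : c ≤ n) (s : Spin N k) :
    subst (args N 0) F • Lam (ket 1 s) ∈ invSpace N k 0 n := by
  have hd := totalDegree_subst_args_le hw hc
  rw [args_zero_eq] at hd ⊢
  exact Submodule.subset_span <| Or.inl <| Or.inl
    ⟨F, s, (pd2_eq_zero_iff 2 F).mpr h2, hd, rfl⟩

theorem mem_F_one {n : ℕ} {c : ℤ} {F : MvPolynomial (Fin 3) ℂ} (hw : WeightLE (wt N 1) c F)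
    (h1 : WeightLE (expo 1) 1 F) (h2 : WeightLE (expo 2) 1 F) (hc : c ≤ n) (s : Spin N k) :
    subst (args N 1) F • Lam (ket 1 s) ∈ invSpace N k 1 n := by
  have hd := totalDegree_subst_args_le hw hc
  rw [args_one_eq] at hd ⊢
  exact Submodule.subset_span <| Or.inl <| Or.inl
    ⟨F, s, (pd2_eq_zero_iff 1 F).mpr h1, (pd2_eq_zero_iff 2 F).mpr h2, hd, rfl⟩

theorem mem_F_two {n : ℕ} {c : ℤ} {F : MvPolynomial (Fin 3) ℂ} (hw : WeightLE (wt N 2) c F)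
    (h0 : WeightLE (expo 0) 1 F) (h1 : WeightLE (expo 1) 1 F) (hc : c ≤ n) (s : Spin N k) :
    subst (args N 2) F • Lam (ket 1 s) ∈ invSpace N k 2 n := by
  have hd := totalDegree_subst_args_le hw hc
  rw [args_two_eq] at hd ⊢
  exact Submodule.subset_span <| Or.inl <| Or.inl
    ⟨F, s, (pd2_eq_zero_iff 0 F).mpr h0, (pd2_eq_zero_iff 1 F).mpr h1, hd, rfl⟩

theorem mem_G_zero {n : ℕ} {c : ℤ} {F : MvPolynomial (Fin 3) ℂ} (hw : WeightLE (wt N 0) c F)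
    (h2 : WeightLE (expo 2) 1 F) (hc : c + 1 ≤ n) (s : Spin N k) :
    subst (args N 0) F • Lam (ket (z 0) s) ∈ invSpace N k 0 n := by
  -- Differentiation can push the degree bound below zero. With integer weights this forces `F = 0`,
  -- in accordance with the convention on negative bounds.
  rcases lt_or_ge c 0 with h | h
  · rw [eq_zero_of_weightLE_wt hw h]
    exact subst_zero_smul_mem _ _ _
  · lift c to ℕ using h
    have hd := totalDegree_subst_args_le hw le_rfl
    rw [args_zero_eq] at hd ⊢
    exact Submodule.subset_span <| Or.inl <| Or.inr
      ⟨F, s, (pd2_eq_zero_iff 2 F).mpr h2, by omega, rfl⟩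

theorem mem_G_one {n : ℕ} {c : ℤ} {F : MvPolynomial (Fin 3) ℂ} (hw : WeightLE (wt N 1) c F)
    (h1 : WeightLE (expo 1) 0 F) (h2 : WeightLE (expo 2) 1 F) (hc : c + 1 ≤ n) (s : Spin N k) :
    subst (args N 1) F • Lam (ket (z 0) s) ∈ invSpace N k 1 n := by
  rcases lt_or_ge c 0 with h | h
  · rw [eq_zero_of_weightLE_wt hw h]
    exact subst_zero_smul_mem _ _ _
  · lift c to ℕ using h
    obtain ⟨g, hg, hd, hp⟩ := exists_eq_subst_rename (e := ![0, 2]) (by decide) 1 (by decide)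
      h1 hw le_rfl
    rw [hg]
    rw [comp_args_one] at hd ⊢
    exact Submodule.subset_span <| Or.inl <| Or.inr ⟨g, s, hp 1 h2, by omega, rfl⟩

theorem mem_G_two {n : ℕ} {c : ℤ} {F : MvPolynomial (Fin 3) ℂ} (hw : WeightLE (wt N 2) c F)
    (h0 : WeightLE (expo 0) 0 F) (h1 : WeightLE (expo 1) 1 F) (hc : c + 1 ≤ n) (s : Spin N k) :
    subst (args N 2) F • Lam (ket (z 0) s) ∈ invSpace N k 2 n := by
  rcases lt_or_ge c 0 with h | h
  · rw [eq_zero_of_weightLE_wt hw h]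
    exact subst_zero_smul_mem _ _ _
  · lift c to ℕ using h
    obtain ⟨g, hg, hd, hp⟩ := exists_eq_subst_rename (e := ![1, 2]) (by decide) 0 (by decide)
      h0 hw le_rfl
    rw [hg]
    rw [comp_args_two] at hd ⊢
    exact Submodule.subset_span <| Or.inl <| Or.inr ⟨g, s, hp 0 h1, by omega, rfl⟩

theorem mem_H_zero {n : ℕ} {c : ℤ} {F : MvPolynomial (Fin 3) ℂ} (hw : WeightLE (wt N 0) c F)
    (h2 : WeightLE (expo 2) 0 F) (hc : c + 2 ≤ n) (s : Spin N k) :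
    subst (args N 0) F • Lam (ket (z 0 ^ 2) s) ∈ invSpace N k 0 n := by
  rcases lt_or_ge c 0 with h | h
  · rw [eq_zero_of_weightLE_wt hw h]
    exact subst_zero_smul_mem _ _ _
  · lift c to ℕ using h
    obtain ⟨g, hg, hd, -⟩ := exists_eq_subst_rename (e := ![0, 1]) (by decide) 2 (by decide)
      h2 hw le_rfl
    rw [hg]
    rw [comp_args_zero] at hd ⊢
    exact Submodule.subset_span <| Or.inr <| Or.inl ⟨g, s, by omega, rfl⟩

theorem mem_H_zero' {n : ℕ} {c : ℤ} {F : MvPolynomial (Fin 3) ℂ} (hw : WeightLE (wt N 0) c F)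
    (h2 : WeightLE (expo 2) 0 F) (hc : c + 2 ≤ n) {s : Spin N k} (hs : s ∈ SpinPrime N k) :
    subst (args N 0) F • Lam (ket (z 0 * z 1) s) ∈ invSpace N k 0 n := by
  rcases lt_or_ge c 0 with h | h
  · rw [eq_zero_of_weightLE_wt hw h]
    exact subst_zero_smul_mem _ _ _
  · lift c to ℕ using h
    obtain ⟨g, hg, hd, -⟩ := exists_eq_subst_rename (e := ![0, 1]) (by decide) 2 (by decide)
      h2 hw le_rfl
    rw [hg]
    rw [comp_args_zero] at hd ⊢
    exact Submodule.subset_span <| Or.inr <| Or.inr ⟨g, s, hs, by omega, rfl⟩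

theorem X_dvd_of_weightLE {i : Fin 3} {F : MvPolynomial (Fin 3) ℂ}
    (h : WeightLE (-expo i) (-1) F) : X i ∣ F := by
  rw [F.as_sum]
  refine Finset.dvd_sum fun m hm => X_dvd_monomial.mpr (Or.inr fun h0 => ?_)
  have := h m (mem_support_iff.mp hm)
  simp [Pi.single_apply, h0] at this

theorem mem_H_two {n : ℕ} {c : ℤ} {F : MvPolynomial (Fin 3) ℂ} (hw : WeightLE (wt N 2) c F)
    (h0 : WeightLE (expo 0) 1 F) (h1 : WeightLE (expo 1) 0 F) (h2 : WeightLE (-expo 2) (-1) F)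
    (hc : c ≤ n + 1) (s : Spin N k) :
    subst (args N 2) F • Lam (ket (z 0)⁻¹ s) ∈ invSpace N k 2 n := by
  obtain ⟨G, rfl⟩ := X_dvd_of_weightLE h2
  -- Cancelling the factor τ_N lowers every weight bound by the weight of τ_N.
  have hG {v : Fin 3 → ℤ} {b : ℤ} (h : WeightLE v b (X 2 * G)) : WeightLE v (b - v 2) G := by
    intro m hm
    have := h (Finsupp.single 2 1 + m) (by rwa [coeff_X_mul])
    simp only [Finsupp.add_apply, Nat.cast_add, mul_add, Finset.sum_add_distrib] at this
    have e : ∑ j, v j * ((Finsupp.single (2 : Fin 3) 1 j : ℕ) : ℤ) = v 2 := by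
      simp [Finsupp.single_apply]
    linarith
  have hwG : WeightLE (wt N 2) (c - N) G := hG hw
  have h0G : WeightLE (expo 0) 1 G := (hG h0).mono (by simp)
  have h1G : WeightLE (expo 1) 0 G := (hG h1).mono (by simp)
  rcases lt_or_ge (c - N) 0 with h | h
  · rw [eq_zero_of_weightLE_wt hwG h, mul_zero]
    exact subst_zero_smul_mem _ _ _
  · obtain ⟨d, hd'⟩ := Int.eq_ofNat_of_zero_le h
    obtain ⟨g, hg, hd, hp⟩ := exists_eq_subst_rename (e := ![0, 2]) (by decide) 1 (by decide)
      h1G hwG hd'.le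
    have e : subst (args N 2) (X 2 * G) = tau N N * subst (args N 2) G := by
      rw [subst, map_mul, aeval_X]
      rfl
    rw [e, hg]
    rw [comp_args_two'] at hd ⊢
    exact Submodule.subset_span <| Or.inr ⟨g, s, hp 0 h0G, by omega, rfl⟩

end

noncomputable section

variable {N k : ℕ}

/-! ### Invariance -/

theorem ratMap_smul_state (p : Poly N) (Ψ : State N k) : ratMap N p • Ψ = p • Ψ := by
  funext s
  rw [poly_smul_apply, Pi.smul_apply, smul_eq_mul]

theorem subst_args_X_mul {ε : Fin 3} (i : Fin 3) (F : MvPolynomial (Fin 3) ℂ) :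
    subst (args N ε) (X i * F) = args N ε i * subst (args N ε) F := by
  rw [subst, map_mul, aeval_X]

theorem expo_apply (i j : Fin 3) : expo i j = if j = i then 1 else 0 := Pi.single_apply _ _ _

theorem WeightLE.pderiv_expo_self {i : Fin 3} {F : MvPolynomial (Fin 3) ℂ}
    (h : WeightLE (expo i) 1 F) : WeightLE (expo i) 0 (MvPolynomial.pderiv i F) :=
  WeightLE.pderiv i (h.mono (by rw [expo_apply]; simp))

theorem WeightLE.pderiv_expo {i j : Fin 3} {c : ℤ} {F : MvPolynomial (Fin 3) ℂ}
    (h : WeightLE (expo i) c F) : WeightLE (expo i) c (MvPolynomial.pderiv j F) :=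
  WeightLE.pderiv j (h.mono (by rw [expo_apply]; split_ifs <;> norm_num))

theorem wt_zero : wt N 0 0 = 1 ∧ wt N 0 1 = 2 ∧ wt N 0 2 = 3 := ⟨rfl, rfl, rfl⟩

theorem wt_one : wt N 1 0 = 1 ∧ wt N 1 1 = 2 ∧ wt N 1 2 = N := ⟨rfl, rfl, rfl⟩

theorem wt_two : wt N 2 0 = 1 ∧ wt N 2 1 = (N - 1 : ℕ) ∧ wt N 2 2 = N := ⟨rfl, rfl, rfl⟩

theorem two_mul_eq_smul (x : RatFun N) : 2 * x = (2 : ℂ) • x := by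
  rw [Algebra.smul_def]; congr 1; exact (map_ofNat _ 2).symm

theorem gam_sig_z (ε : Fin 3) (m : ℕ) (i : Fin N) :
    gam ε (ratMap N (sig N m)) (z i) = z i ^ (ε : ℕ) * (m * z i ^ (m - 1)) := by
  rw [gam_z, pd_sig]

theorem Lam_ket_natCast_mul (m : ℕ) (f : RatFun N) (v : Spin N k) :
    Lam (ket ((m : RatFun N) * f) v) = (m : ℂ) • Lam (ket f v) := by
  rw [← Lam_ket_smul, Algebra.smul_def, map_natCast]

theorem gam_zero_sig_one_z_sq (i : Fin N) :
    gam 0 (ratMap N (sig N 1)) (z i ^ 2) = ((2 : ℕ) : RatFun N) * z i := by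
  rw [Derivation.leibniz_pow, gam_sig_z]; simp

theorem gam_zero_sig_two_z_sq (i : Fin N) :
    gam 0 (ratMap N (sig N 2)) (z i ^ 2) = ((4 : ℕ) : RatFun N) * z i ^ 2 := by
  rw [Derivation.leibniz_pow, gam_sig_z]; simp; ring

theorem gam_zero_sig_one_z_mul_z (i j : Fin N) :
    gam 0 (ratMap N (sig N 1)) (z i * z j) = z i + z j := by
  rw [Derivation.leibniz, gam_sig_z, gam_sig_z]; simp

theorem gam_zero_sig_two_z_mul_z (i j : Fin N) :
    gam 0 (ratMap N (sig N 2)) (z i * z j) = ((4 : ℕ) : RatFun N) * (z i * z j) := by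
  rw [Derivation.leibniz, gam_sig_z, gam_sig_z]; simp; ring

theorem linVal_permVar (ε : Fin 3) (π : Equiv.Perm (Fin N)) (x : RatFun N) :
    linVal ε (permVar π x) = permVar π (linVal ε x) := by
  fin_cases ε <;> simp [linVal, map_ofNat (permVar π) 2]

theorem permVar_smul (π : Equiv.Perm (Fin N)) (c : ℂ) (x : RatFun N) :
    permVar π (c • x) = c • permVar π x := (permVar π).toLinearMap.map_smul c x

variable [NeZero N]

theorem TScalar_const_one (ε : Fin 3) (a : ℝ) : TScalar ε a (1 : RatFun N) = 0 := by
  have h (i : Fin N) : pairTerm ε i 1 = 0 := pairTerm_of_const ε i (by simp) (by simp) (by simp)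
  simp [TScalar_apply, h]

theorem T_Lam_ket_one (ε : Fin 3) (a : ℝ) (s : Spin N k) : T ε a (Lam (ket 1 s)) = 0 := by
  rw [T_Lam_ket ε a (g := 0) (fun π => by rw [map_one, map_zero, TScalar_const_one]), ket_zero,
    map_zero]

theorem T_Lam_ket_z (hN : 2 ≤ N) (ε : Fin 3) (a : ℝ) (s : Spin N k) :
    T ε a (Lam (ket (z 0) s)) = (4 * a : ℂ) • Lam (ket (linVal ε (z 0)) s) := by
  rw [← Lam_ket_smul]
  refine T_Lam_ket ε a (fun π => ?_) s
  rw [permVar_z, TScalar_z hN, two_mul_eq_smul, smul_smul, permVar_smul, ← linVal_permVar, permVar_z]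
  congr 1
  ring

theorem T_Lam_ket_z_sq (hN : 2 ≤ N) (a : ℝ) (s : Spin N k) :
    T 0 a (Lam (ket (z 0 ^ 2) s)) = (2 + 4 * a : ℂ) • Lam (ket 1 s) := by
  rw [← Lam_ket_smul]
  refine T_Lam_ket 0 a (fun π => ?_) s
  rw [map_pow, permVar_z, TScalar_zero_z_sq hN, permVar_smul, map_one]

theorem T_Lam_ket_z_inv (hN : 2 ≤ N) (a : ℝ) (s : Spin N k) :
    T 2 a (Lam (ket (z 0)⁻¹ s)) = (2 : ℂ) • Lam (ket (z 0)⁻¹ s) := by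
  rw [← Lam_ket_smul]
  refine T_Lam_ket 2 a (fun π => ?_) s
  rw [map_inv₀, permVar_z, TScalar_two_z_inv hN, permVar_smul, map_inv₀, permVar_z, two_mul_eq_smul]

/-- An unordered neighbouring pair occurs once among the ordered index pairs. The symmetry of `w` is
needed where the cycle wraps around and p + 1 < p. -/
theorem sum_pair_eq (hN : 2 ≤ N) (w : Fin N → Fin N → ℂ) (hw : ∀ i j, w i j = w j i) (p : Fin N) :
    ∑ j, ∑ l ∈ Finset.univ.filter (fun l => j < l),
      (if (j = p ∧ l = p + 1) ∨ (j = p + 1 ∧ l = p) then w j l else 0) = w p (p + 1) := by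
  have key (x y : Fin N) (hxy : x < y) :
      ∑ j, ∑ l ∈ Finset.univ.filter (fun l => j < l),
        (if (j = x ∧ l = y) ∨ (j = y ∧ l = x) then w j l else 0) = w x y := by
    rw [Finset.sum_eq_single x, Finset.sum_eq_single y]
    · simp
    · intro l _ hl
      simp [hl, hxy.ne]
    · intro h
      simp [hxy] at h
    · intro j _ hj
      refine Finset.sum_eq_zero fun l hl => if_neg ?_
      have hjl := (Finset.mem_filter.mp hl).2
      rintro (⟨h, _⟩ | ⟨rfl, rfl⟩)
      · exact hj h
      · exact absurd hxy hjl.not_gt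
    · simp
  rcases lt_or_gt_of_ne (add_one_ne_self hN p).symm with h | h
  · exact key _ _ h
  · rw [hw, ← key _ _ h]
    refine Finset.sum_congr rfl fun j _ => Finset.sum_congr rfl fun l _ => ?_
    simp only [or_comm]

theorem T_Lam_ket_z_mul_z (hN : 2 ≤ N) (a : ℝ) {v : Spin N k} (hv : v ∈ SpinPrime N k) :
    ∃ s : Spin N k, T 0 a (Lam (ket (z 0 * z 1) v)) = Lam (ket 1 s) := by
  obtain ⟨w, hw, he, hs⟩ := hv
  -- For ε = 0 each neighbouring pair contributes -2a and every other part vanishes. The resulting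
  -- constant state is in the range of Λ because its spin vector is symmetric.
  refine ⟨(-(2 * a) : ℂ) • ∑ i, w i (i + 1), ?_⟩
  rw [Lam_ket_of_isSymm fun π => by rw [map_smul, hs π], he]
  funext s
  have hT (j l : Fin N) (hjl : j < l) : T 0 a (ket (z j * z l) (w j l)) s =
      (-(2 * a) : ℂ) • ∑ i : Fin N, (if (j = i ∧ l = i + 1) ∨ (j = i + 1 ∧ l = i) then w j l s
        else 0) • (1 : RatFun N) := by
    rw [T_ket, TScalar_z_mul_z hN 0 a hjl.ne]
    simp only [ket, linVal, theta, zero_mul, mul_zero, add_zero, zero_add, neg_smul, smul_smul]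
    rw [mul_comm, ← smul_smul, Finset.smul_sum, ← smul_neg, ← Finset.sum_neg_distrib]
    congr 1
    refine Finset.sum_congr rfl fun i _ => ?_
    split_ifs <;> simp
  have hsum : T 0 a (∑ i, ∑ j ∈ Finset.univ.filter (fun j => i < j), ket (z i * z j) (w i j)) s =
      (-(2 * a) : ℂ) • ∑ p : Fin N, (∑ j, ∑ l ∈ Finset.univ.filter (fun l => j < l),
        (if (j = p ∧ l = p + 1) ∨ (j = p + 1 ∧ l = p) then w j l s else 0)) •
          (1 : RatFun N) := by
    simp only [map_sum, Finset.sum_apply]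
    rw [Finset.sum_congr rfl fun j _ => Finset.sum_congr rfl fun l hl =>
      hT j l (Finset.mem_filter.mp hl).2]
    simp only [← Finset.smul_sum, ← Finset.sum_smul]
    congr 2
    rw [Finset.sum_comm]
    refine Finset.sum_congr rfl fun j _ => ?_
    rw [Finset.sum_comm]
  rw [hsum]
  simp only [sum_pair_eq hN (fun i j => w i j s) (fun i j => by rw [hw])]
  simp [ket, Finset.sum_smul, Finset.smul_sum, mul_smul]

/-- Needed because Γ_0(σ_1, z_1z_2) = z_1 + z_2, while the generators contain only the first
variable. -/
theorem Lam_ket_z_one (v : Spin N k) :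
    Lam (ket (z 1) v) = Lam (ket (z 0) (permSpin (Equiv.swap 0 1) v)) := by
  rw [← Lam_permState (Equiv.swap 0 1), permState_ket, permVar_swap_z_right]

theorem T_mem_zero (hN : 2 ≤ N) (a : ℝ) (n : ℕ) {Ψ : State N k}
    (hΨ : Ψ ∈ genF N k 0 n ∪ genG N k 0 n ∪ genH N k 0 n) : T 0 a Ψ ∈ invSpace N k 0 n := by
  have hop {F} {c : ℤ} (hw : WeightLE (wt N 0) c F) : WeightLE (wt N 0) c (formalT N 0 a F) := by
    apply formalT_zero_weightLE a hw <;> simp only [wt_zero] <;> norm_num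
  have hop2 {F} {c : ℤ} (hw : WeightLE (expo 2) c F) :
      WeightLE (expo 2) c (formalT N 0 a F) := by
    apply formalT_zero_weightLE a hw <;> simp
  have hd0 {F} {c : ℤ} (hw : WeightLE (wt N 0) c F) :
    WeightLE (wt N 0) (c - 1) (pderiv 0 F) := WeightLE.pderiv 0 (hw.mono (by simp [wt_zero]))
  have hd1 {F} {c : ℤ} (hw : WeightLE (wt N 0) c F) :
    WeightLE (wt N 0) (c - 2) (pderiv 1 F) := WeightLE.pderiv 1 (hw.mono (by simp [wt_zero]))
  have hd2 {F} {c : ℤ} (hw : WeightLE (wt N 0) c F) :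
    WeightLE (wt N 0) (c - 3) (pderiv 2 F) := WeightLE.pderiv 2 (hw.mono (by simp [wt_zero]))
  have smul_mem {c : ℂ} {Φ : State N k} (h : Φ ∈ invSpace N k 0 n) : c • Φ ∈ invSpace N k 0 n :=
    Submodule.smul_mem _ c h
  rcases hΨ with (⟨f, s, h2, hn, rfl⟩ | ⟨g, s, h2, hn, rfl⟩) | (⟨h, s, hn, rfl⟩ | ⟨h, s, hs, hn, rfl⟩)
  · obtain ⟨F, hF, hw, hb⟩ := exists_weightLE_args 0 f hn
    rw [← args_zero_eq, ← hF, T_subst_smul 0 a (args_isSymmetric 0),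
      TScalar_zero_args hN a ((pd2_eq_zero_iff 2 F).mpr (hb 2 h2)), T_Lam_ket_one]
    simp only [Derivation.map_one_eq_zero, ket_zero, map_zero, smul_zero, Finset.sum_const_zero,
      add_zero, zero_add, ratMap_smul_state]
    exact mem_F_zero (hop hw) (hop2 (hb 2 h2)) le_rfl s
  · obtain ⟨F, hF, hw, hb⟩ := exists_weightLE_args 0 g (n := n - 1) (Nat.le_sub_of_add_le hn)
    have hb2 := hb 2 h2
    rw [← args_zero_eq, ← hF, T_subst_smul 0 a (args_isSymmetric 0),
      TScalar_zero_args hN a ((pd2_eq_zero_iff 2 F).mpr hb2), T_Lam_ket_z hN]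
    simp only [Fin.sum_univ_three, args_zero, gam_sig_z, linVal, ket_zero, map_zero, smul_zero,
      zero_add, ratMap_smul_state, Fin.val_zero, pow_zero, one_mul, Lam_ket_natCast_mul,
      Nat.reduceSub, pow_one, mul_one, smul_comm (subst _ _)]
    have h1 : Lam (ket ((1 : ℕ) : RatFun N) s) = Lam (ket 1 s) := by rw [Nat.cast_one]
    rw [h1]
    refine add_mem (mem_G_zero (hop hw) (hop2 hb2) (by omega) s) (smul_mem
      (add_mem (add_mem ?_ (smul_mem ?_)) (smul_mem ?_)))
    · exact mem_F_zero (hd0 hw) hb2.pderiv_expo (by omega) s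
    · exact mem_G_zero (hd1 hw) hb2.pderiv_expo (by omega) s
    -- From Γ_0(σ_3, z_1) = 3z_1². The coefficient ∂g/∂σ_3 is free of σ_3, as this family requires,
    -- because g is linear in σ_3.
    · exact mem_H_zero (hd2 hw) hb2.pderiv_expo_self (by omega) s
  · rw [← comp_args_zero] at hn ⊢
    obtain ⟨F, hF, hw, hb, -⟩ := exists_weightLE_args_rename 0 (e := ![0, 1]) (by decide) h
      (n := n - 2) (Nat.le_sub_of_add_le hn)
    have hb2 := hb 2 (by decide)
    have hb2' : WeightLE (expo 2) 1 F := hb2.mono zero_le_one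
    rw [← hF, T_subst_smul 0 a (args_isSymmetric 0),
      TScalar_zero_args hN a ((pd2_eq_zero_iff 2 F).mpr hb2'), T_Lam_ket_z_sq hN]
    simp only [Fin.sum_univ_three, args_zero, gam_zero_sig_one_z_sq, gam_zero_sig_two_z_sq,
      ratMap_smul_state, Lam_ket_natCast_mul, pderiv_eq_zero_of_weightLE hb2,
      smul_comm (subst _ _)]
    refine add_mem (add_mem (smul_mem ?_) ?_) (smul_mem
      (add_mem (add_mem (smul_mem ?_) (smul_mem ?_)) (subst_zero_smul_mem _ _ _)))
    · exact mem_F_zero hw hb2' (by omega) s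
    · exact mem_H_zero (hop hw) (hop2 hb2) (by omega) s
    · exact mem_G_zero (hd0 hw) hb2'.pderiv_expo (by omega) s
    · exact mem_H_zero (hd1 hw) hb2.pderiv_expo (by omega) s
  · rw [← comp_args_zero] at hn ⊢
    obtain ⟨F, hF, hw, hb, -⟩ := exists_weightLE_args_rename 0 (e := ![0, 1]) (by decide) h
      (n := n - 2) (Nat.le_sub_of_add_le hn)
    have hb2 := hb 2 (by decide)
    have hb2' : WeightLE (expo 2) 1 F := hb2.mono zero_le_one
    obtain ⟨v, hv⟩ := T_Lam_ket_z_mul_z hN a hs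
    rw [← hF, T_subst_smul 0 a (args_isSymmetric 0),
      TScalar_zero_args hN a ((pd2_eq_zero_iff 2 F).mpr hb2'), hv]
    simp only [Fin.sum_univ_three, args_zero, gam_zero_sig_one_z_mul_z, gam_zero_sig_two_z_mul_z,
      ratMap_smul_state, Lam_ket_natCast_mul, pderiv_eq_zero_of_weightLE hb2, ket_add, map_add,
      Lam_ket_z_one, smul_comm (subst _ _)]
    rw [smul_add (subst _ _)]
    refine add_mem (add_mem ?_ ?_) (smul_mem
      (add_mem (add_mem (add_mem ?_ ?_) (smul_mem ?_)) (subst_zero_smul_mem _ _ _)))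
    · exact mem_F_zero hw hb2' (by omega) _
    · exact mem_H_zero' (hop hw) (hop2 hb2) (by omega) hs
    · exact mem_G_zero (hd0 hw) hb2'.pderiv_expo (by omega) _
    · exact mem_G_zero (hd0 hw) hb2'.pderiv_expo (by omega) _
    · exact mem_H_zero' (hd1 hw) hb2.pderiv_expo (by omega) hs

theorem T_mem_one (hN : 2 ≤ N) (a : ℝ) (n : ℕ) {Ψ : State N k}
    (hΨ : Ψ ∈ genF N k 1 n ∪ genG N k 1 n ∪ genH N k 1 n) : T 1 a Ψ ∈ invSpace N k 1 n := by
  have hop {F} {c : ℤ} (hw : WeightLE (wt N 1) c F) : WeightLE (wt N 1) c (formalT N 1 a F) := by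
    apply formalT_one_weightLE a hw <;> simp only [wt_one] <;> norm_num
  have hop2 {F} {c : ℤ} (hw : WeightLE (expo 2) c F) :
      WeightLE (expo 2) c (formalT N 1 a F) := by
    apply formalT_one_weightLE a hw <;> simp
  have hop1 {F} {c : ℤ} (hw : WeightLE (expo 1) c F) :
      WeightLE (expo 1) c (formalT N 1 a F) := by
    apply formalT_one_weightLE a hw <;> simp
  have hd0 {F} {c : ℤ} (hw : WeightLE (wt N 1) c F) :
    WeightLE (wt N 1) (c - 1) (pderiv 0 F) := WeightLE.pderiv 0 (hw.mono (by simp [wt_one]))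
  have smul_mem {c : ℂ} {Φ : State N k} (h : Φ ∈ invSpace N k 1 n) : c • Φ ∈ invSpace N k 1 n :=
    Submodule.smul_mem _ c h
  rcases hΨ with (⟨f, s, h1, h2, hn, rfl⟩ | ⟨g, s, h2, hn, rfl⟩) | hΨ
  · obtain ⟨F, hF, hw, hb⟩ := exists_weightLE_args 1 f hn
    rw [← args_one_eq, ← hF, T_subst_smul 1 a (args_isSymmetric 1),
      TScalar_one_args hN a ((pd2_eq_zero_iff 1 F).mpr (hb 1 h1))
        ((pd2_eq_zero_iff 2 F).mpr (hb 2 h2)), T_Lam_ket_one]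
    simp only [Derivation.map_one_eq_zero, ket_zero, map_zero, smul_zero, Finset.sum_const_zero,
      add_zero, zero_add, ratMap_smul_state]
    exact mem_F_one (hop hw) (hop1 (hb 1 h1)) (hop2 (hb 2 h2)) le_rfl s
  · rw [← comp_args_one] at hn ⊢
    obtain ⟨F, hF, hw, hb, hb'⟩ := exists_weightLE_args_rename 1 (e := ![0, 2]) (by decide) g
      (n := n - 1) (Nat.le_sub_of_add_le hn)
    have hb1 := hb 1 (by decide)
    have hb1' : WeightLE (expo 1) 1 F := hb1.mono zero_le_one
    have hb2 : WeightLE (expo 2) 1 F := hb' 1 h2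
    have half : linVal 1 (z (0 : Fin N)) = (1 / 2 : ℂ) • (1 : RatFun N) := by
      rw [linVal, Algebra.smul_def, mul_one, map_div₀, map_one, map_ofNat]
    have e0 : gam 1 (ratMap N (sig N 1)) (z 0) = z 0 := by rw [gam_sig_z]; simp
    have e2 : gam 1 (ratMap N (tau N N)) (z 0) = ratMap N (tau N N) * 1 := by
      rw [gam_one_tau_top]; simp [pd_z]
    rw [← hF, T_subst_smul 1 a (args_isSymmetric 1),
      TScalar_one_args hN a ((pd2_eq_zero_iff 1 F).mpr hb1') ((pd2_eq_zero_iff 2 F).mpr hb2),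
      T_Lam_ket_z hN, half]
    simp only [Fin.sum_univ_three, args_one, e0, e2, ratMap_smul_state, Lam_ket_smul,
      Lam_ket_ratMap_mul (tau_isSymmetric N), pderiv_eq_zero_of_weightLE hb1,
      smul_comm (subst _ _) (_ : ℂ)]
    -- The factor τ_N from Γ_1(τ_N, z_1) = τ_N is absorbed into the coefficient, where it restores
    -- the exponent lost by differentiation.
    have eX : subst (args N 1) (pderiv 2 F) • tau N N • Lam (ket 1 s) =
        subst (args N 1) (X 2 * pderiv 2 F) • Lam (ket 1 s) := by
      rw [subst_args_X_mul, smul_smul, mul_comm]; rfl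
    rw [eX]
    refine add_mem (add_mem (smul_mem (smul_mem ?_)) ?_) (smul_mem
      (add_mem (add_mem ?_ (subst_zero_smul_mem _ _ _)) ?_))
    · exact mem_F_one hw hb1' hb2 (by omega) s
    · exact mem_G_one (hop hw) (hop1 hb1) (hop2 hb2) (by omega) s
    · exact mem_G_one (hd0 hw) hb1.pderiv_expo hb2.pderiv_expo (by omega) s
    · refine mem_F_one (c := (n - 1 : ℕ)) ?_ ?_ ?_ (by omega) s
      · exact WeightLE.X_mul 2 (WeightLE.pderiv 2 (hw.mono (by simp)))
      · exact WeightLE.X_mul 2 (WeightLE.pderiv 2 (hb1'.mono (by simp)))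
      · exact WeightLE.X_mul 2 (WeightLE.pderiv 2 (hb2.mono (by simp)))
  · exact hΨ.elim

theorem T_mem_two (hN : 2 ≤ N) (a : ℝ) (n : ℕ) {Ψ : State N k}
    (hΨ : Ψ ∈ genF N k 2 n ∪ genG N k 2 n ∪ genH N k 2 n) : T 2 a Ψ ∈ invSpace N k 2 n := by
  have hop {F} {c : ℤ} (hw : WeightLE (wt N 2) c F) : WeightLE (wt N 2) c (formalT N 2 a F) := by
    apply formalT_two_weightLE a hw
    simp only [wt_two]
    omega
  have hop0 {F} {c : ℤ} (hw : WeightLE (expo 0) c F) :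
      WeightLE (expo 0) c (formalT N 2 a F) := by
    apply formalT_two_weightLE a hw; simp
  have hop1 {F} {c : ℤ} (hw : WeightLE (expo 1) c F) :
      WeightLE (expo 1) c (formalT N 2 a F) := by
    apply formalT_two_weightLE a hw; simp
  have hop2 {F} {c : ℤ} (hw : WeightLE (-expo 2) c F) :
      WeightLE (-expo 2) c (formalT N 2 a F) := by
    apply formalT_two_weightLE a hw; simp
  have hX {v : Fin 3 → ℤ} {c : ℤ} {F} (i : Fin 3) (h : WeightLE v c F) :
      WeightLE v c (X i * pderiv i F) :=
    WeightLE.X_mul i (WeightLE.pderiv i (h.mono (by simp)))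
  have hX' {v : Fin 3 → ℤ} {c : ℤ} {F} (i j : Fin 3) (h : WeightLE v c F) :
      WeightLE v (c + v i - v j) (X i * pderiv j F) :=
    WeightLE.X_mul i (WeightLE.pderiv j (h.mono (by linarith)))
  have smul_mem {c : ℂ} {Φ : State N k} (h : Φ ∈ invSpace N k 2 n) : c • Φ ∈ invSpace N k 2 n :=
    Submodule.smul_mem _ c h
  have eX (i j : Fin 3) (F) (Φ : State N k) : subst (args N 2) (pderiv i F) • args N 2 j • Φ =
      subst (args N 2) (X j * pderiv i F) • Φ := by
    rw [subst_args_X_mul, smul_smul, mul_comm]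
  have eX1 (i : Fin 3) (F) (Φ : State N k) :
      subst (args N 2) (pderiv i F) • tau N (N - 1) • Φ =
        subst (args N 2) (X 1 * pderiv i F) • Φ := eX i 1 F Φ
  have eX2 (i : Fin 3) (F) (Φ : State N k) : subst (args N 2) (pderiv i F) • tau N N • Φ =
      subst (args N 2) (X 2 * pderiv i F) • Φ := eX i 2 F Φ
  rcases hΨ with (⟨f, s, h0, h1, hn, rfl⟩ | ⟨g, s, h1, hn, rfl⟩) | ⟨q, s, h0, hn, rfl⟩
  · obtain ⟨F, hF, hw, hb⟩ := exists_weightLE_args 2 f hn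
    rw [← args_two_eq, ← hF, T_subst_smul 2 a (args_isSymmetric 2),
      TScalar_two_args hN a ((pd2_eq_zero_iff 0 F).mpr (hb 0 h0))
        ((pd2_eq_zero_iff 1 F).mpr (hb 1 h1)), T_Lam_ket_one]
    simp only [Derivation.map_one_eq_zero, ket_zero, map_zero, smul_zero, Finset.sum_const_zero,
      add_zero, zero_add, ratMap_smul_state]
    exact mem_F_two (hop hw) (hop0 (hb 0 h0)) (hop1 (hb 1 h1)) le_rfl s
  · rw [← comp_args_two] at hn ⊢
    obtain ⟨F, hF, hw, hb, hb'⟩ := exists_weightLE_args_rename 2 (e := ![1, 2]) (by decide) g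
      (n := n - 1) (Nat.le_sub_of_add_le hn)
    have hb0 := hb 0 (by decide)
    have hb0' : WeightLE (expo 0) 1 F := hb0.mono zero_le_one
    have hb1 : WeightLE (expo 1) 1 F := hb' 0 h1
    have e1 : gam 2 (ratMap N (tau N (N - 1))) (z 0) =
        ratMap N (tau N (N - 1)) * z 0 - ratMap N (tau N N) * 1 := by
      rw [gam_two_tau_pred]; simp [pd_z]
    have e2 : gam 2 (ratMap N (tau N N)) (z 0) = ratMap N (tau N N) * z 0 := by
      rw [gam_two_tau_top]; simp [pd_z]
    have e3 : linVal 2 (z (0 : Fin N)) = z 0 := rfl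
    rw [← hF, T_subst_smul 2 a (args_isSymmetric 2),
      TScalar_two_args hN a ((pd2_eq_zero_iff 0 F).mpr hb0') ((pd2_eq_zero_iff 1 F).mpr hb1),
      T_Lam_ket_z hN, e3]
    simp only [Fin.sum_univ_three, args_two, e1, e2, ratMap_smul_state, ket_sub, map_sub,
      Lam_ket_ratMap_mul (tau_isSymmetric _), pderiv_eq_zero_of_weightLE hb0,
      smul_comm (subst _ _) (_ : ℂ)]
    rw [smul_sub (subst _ _), eX1, eX2, eX2]
    refine add_mem (add_mem (smul_mem ?_) ?_) (smul_mem
      (add_mem (add_mem (subst_zero_smul_mem _ _ _) (sub_mem ?_ ?_)) ?_))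
    · exact mem_G_two hw hb0 hb1 (by omega) s
    · exact mem_G_two (hop hw) (hop0 hb0) (hop1 hb1) (by omega) s
    · exact mem_G_two (hX 1 hw) (hX 1 hb0) (hX 1 hb1) (by omega) s
    -- The term -τ_N of Γ_2(τ_{N-1}, z_1): replacing a factor τ_{N-1} by τ_N raises the degree by
    -- one, from n - 1 to the bound n for factorized states.
    · refine mem_F_two (hX' 2 1 hw) ((hX' 2 1 hb0').mono (by simp)) ((hX' 2 1 hb1).mono (by simp))
        ?_ s
      simp only [wt_two]
      omega
    · exact mem_G_two (hX 2 hw) (hX 2 hb0) (hX 2 hb1) (by omega) s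
  · rw [← comp_args_two'] at hn ⊢
    have hn' : (subst (args N 2 ∘ ![0, 2]) q).totalDegree ≤ n + 1 - N := by omega
    obtain ⟨G, hG, hwG, hb, hb'⟩ := exists_weightLE_args_rename 2 (e := ![0, 2]) (by decide) q hn'
    have hG1 := hb 1 (by decide)
    have hG0 : WeightLE (expo 0) 1 G := hb' 0 h0
    have hG2 : WeightLE (-expo 2) 0 G := by
      intro m _
      simp [Fin.sum_univ_three]
    rw [← hG, show tau N N * subst (args N 2) G = subst (args N 2) (X 2 * G) from
      (subst_args_X_mul (ε := 2) 2 G).symm]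
    -- With τ_N included the coefficient may have degree n + 1, since the seed 1/z_1 has degree -1.
    have hw : WeightLE (wt N 2) (n + 1) (X 2 * G) := by
      refine WeightLE.X_mul 2 (hwG.mono ?_)
      simp only [wt_two]
      omega
    have hb0 : WeightLE (expo 0) 1 (X 2 * G) := WeightLE.X_mul 2 (hG0.mono (by simp))
    have hb1 : WeightLE (expo 1) 0 (X 2 * G) := WeightLE.X_mul 2 (hG1.mono (by simp))
    have hb2 : WeightLE (-expo 2) (-1) (X 2 * G) := WeightLE.X_mul 2 (hG2.mono (by simp))
    generalize X 2 * G = F at hw hb0 hb1 hb2 ⊢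
    have hb1' : WeightLE (expo 1) 1 F := hb1.mono zero_le_one
    have h00 := z_ne_zero (0 : Fin N)
    have e0 : gam 2 (ratMap N (sig N 1)) (z 0)⁻¹ = (-1 : ℂ) • 1 := by
      rw [Derivation.leibniz_inv, gam_sig_z]
      simp
      field_simp
    have e2 : gam 2 (ratMap N (tau N N)) (z 0)⁻¹ =
        (-1 : ℂ) • (ratMap N (tau N N) * (z 0)⁻¹) := by
      rw [Derivation.leibniz_inv, gam_two_tau_top]
      simp [pd_z]
      field_simp
    rw [T_subst_smul 2 a (args_isSymmetric 2),
      TScalar_two_args hN a ((pd2_eq_zero_iff 0 F).mpr hb0) ((pd2_eq_zero_iff 1 F).mpr hb1'),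
      T_Lam_ket_z_inv hN]
    simp only [Fin.sum_univ_three, args_two, e0, e2, ratMap_smul_state, Lam_ket_smul,
      Lam_ket_ratMap_mul (tau_isSymmetric _), pderiv_eq_zero_of_weightLE hb1,
      smul_comm (subst _ _) (_ : ℂ), eX2]
    refine add_mem (add_mem (smul_mem ?_) ?_) (smul_mem
      (add_mem (add_mem (smul_mem ?_) (subst_zero_smul_mem _ _ _)) (smul_mem ?_)))
    · exact mem_H_two hw hb0 hb1 hb2 le_rfl s
    · exact mem_H_two (hop hw) (hop0 hb0) (hop1 hb1) (hop2 hb2) le_rfl s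
    -- From Γ_2(σ_1, 1/z_1) = -1: the derivative in σ_1 brings the degree from n + 1 down to n.
    · refine mem_F_two (c := n) (WeightLE.pderiv 0 (hw.mono ?_)) hb0.pderiv_expo
        hb1'.pderiv_expo le_rfl s
      simp only [wt_two]
      exact le_rfl
    · exact mem_H_two (hX 2 hw) (hX 2 hb0) (hX 2 hb1) (hX 2 hb2) le_rfl s

theorem T_mem_invSpace (hN : 2 ≤ N) (ε : Fin 3) (a : ℝ) (n : ℕ) {Ψ : State N k}
    (hΨ : Ψ ∈ invSpace N k ε n) : T ε a Ψ ∈ invSpace N k ε n := by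
  refine (Submodule.span_le (p := (invSpace N k ε n).comap (T ε a))).mpr ?_ hΨ
  intro Φ hΦ
  match ε with
  | 0 => exact T_mem_zero hN a n hΦ
  | 1 => exact T_mem_one hN a n hΦ
  | 2 => exact T_mem_two hN a n hΦ

end

noncomputable section

variable {N k : ℕ}

/-! ### Polynomial states -/

theorem ket_ratMap_mem_polyState {p : Poly N} {n : ℕ} (hp : p.totalDegree ≤ n) (v : Spin N k) :
    ket (ratMap N p) v ∈ polyState N k n := by
  rw [polyState, Submodule.mem_pi]
  intro s _
  exact Submodule.smul_mem _ _ ⟨p, (mem_restrictTotalDegree _ _ _).mpr hp, rfl⟩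

theorem finiteDimensional_polyState (N k n : ℕ) : FiniteDimensional ℂ (polyState N k n) := by
  let W : Submodule ℂ (RatFun N) := (restrictTotalDegree (Fin N) ℂ n).map
    (IsScalarTower.toAlgHom ℂ (Poly N) (RatFun N)).toLinearMap
  have hle : polyState N k n ≤ LinearMap.range (W.subtype.compLeft (Config N k)) := by
    intro Ψ hΨ
    exact ⟨fun s => ⟨Ψ s, Submodule.mem_pi.mp hΨ s (Set.mem_univ s)⟩, rfl⟩
  exact Submodule.finiteDimensional_of_le hle

theorem smul_Lam_ket_mem {p q : Poly N} (hp : p.IsSymmetric) {f : RatFun N} {n : ℕ}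
    (hq : q.totalDegree ≤ n) (h : ratMap N p * f = ratMap N q) (v : Spin N k) :
    p • Lam (ket f v) ∈ (polyState N k n).map Lam := by
  rw [← Lam_ket_ratMap_mul hp, h]
  exact Submodule.mem_map_of_mem (ket_ratMap_mem_polyState hq v)

theorem smul_Lam_ket_ratMap_mem {p q : Poly N} (hp : p.IsSymmetric) {n d : ℕ}
    (hq : q.totalDegree ≤ d) (hd : p.totalDegree + d ≤ n) (v : Spin N k) :
    p • Lam (ket (ratMap N q) v) ∈ (polyState N k n).map Lam :=
  smul_Lam_ket_mem hp ((totalDegree_mul p q).trans (by omega)) (map_mul _ _ _).symm v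

theorem subst_args_isSymmetric (ε : Fin 3) (f : MvPolynomial (Fin 3) ℂ) :
    (subst (args N ε) f).IsSymmetric := subst_isSymmetric (args_isSymmetric ε) f

theorem subst_args_comp_isSymmetric (ε : Fin 3) (e : Fin 2 → Fin 3) (f : MvPolynomial (Fin 2) ℂ) :
    (subst (args N ε ∘ e) f).IsSymmetric := subst_isSymmetric (fun i => args_isSymmetric ε (e i)) f

theorem exists_of_mem_genF {ε : Fin 3} {n : ℕ} {Ψ : State N k} (h : Ψ ∈ genF N k ε n) :
    ∃ (p : Poly N) (s : Spin N k), p.IsSymmetric ∧ p.totalDegree ≤ n ∧ Ψ = p • Lam (ket 1 s) := by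
  match ε with
  | 0 =>
    obtain ⟨f, s, -, hn, rfl⟩ := h
    exact ⟨_, s, subst_args_isSymmetric 0 f, hn, rfl⟩
  | 1 =>
    obtain ⟨f, s, -, -, hn, rfl⟩ := h
    exact ⟨_, s, subst_args_isSymmetric 1 f, hn, rfl⟩
  | 2 =>
    obtain ⟨f, s, -, -, hn, rfl⟩ := h
    exact ⟨_, s, subst_args_isSymmetric 2 f, hn, rfl⟩

/-- Each coordinate of a generator is a symmetric polynomial times a complex number. This is the
invariant that separates factorized states from the others. -/
theorem permVar_apply_of_mem_factorized {ε : Fin 3} {n : ℕ} {Ψ : State N k}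
    (h : Ψ ∈ factorized N k ε n) (π : Equiv.Perm (Fin N)) (s : Config N k) :
    permVar π (Ψ s) = Ψ s := by
  induction h using Submodule.span_induction with
  | mem Ψ h =>
    obtain ⟨p, v, hp, -, rfl⟩ := exists_of_mem_genF h
    rw [poly_smul_apply, map_mul, permVar_ratMap_of_isSymmetric π hp, Lam_ket]
    congr 1
    simp only [map_one, Pi.smul_apply, Finset.sum_apply, ket, permVar_smul, map_sum]
  | zero => simp
  | add Ψ Φ _ _ h1 h2 => rw [Pi.add_apply, map_add, h1, h2]
  | smul c Ψ _ h1 => rw [Pi.smul_apply, permVar_smul, h1]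

/-- The constant spin vector is fixed by all permutations, so Λ averages `p` over the variables;
evaluation at (1, …, 1) does not see this averaging. -/
theorem Lam_ket_one_ne_zero {p : Poly N} (hp : eval (fun _ => 1) p ≠ 0) :
    Lam (ket (ratMap N p) (fun _ : Config N k => (1 : ℂ))) ≠ 0 := by
  intro h
  have h0 := congrFun h 0
  rw [Lam_ket] at h0
  simp only [Pi.smul_apply, Finset.sum_apply, ket, permSpin, LinearMap.coe_mk, AddHom.coe_mk,
    one_smul, permVar_ratMap, ← map_sum, Pi.zero_apply] at h0
  rcases smul_eq_zero.mp h0 with h1 | h1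
  · exact inv_ne_zero (Nat.cast_ne_zero.mpr N.factorial_ne_zero) h1
  · have h2 := congrArg (eval fun _ => (1 : ℂ)) (ratMap_injective (h1.trans (map_zero _).symm))
    simp only [map_sum, eval_rename, map_zero] at h2
    simp only [Function.comp_def, Finset.sum_const, Finset.card_univ, Fintype.card_perm,
      Fintype.card_fin, nsmul_eq_mul] at h2
    exact mul_ne_zero (Nat.cast_ne_zero.mpr N.factorial_ne_zero) hp h2

variable [NeZero N]

theorem exists_of_mem_genG {ε : Fin 3} {n : ℕ} {Ψ : State N k} (h : Ψ ∈ genG N k ε n) :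
    ∃ (p : Poly N) (s : Spin N k), p.IsSymmetric ∧ p.totalDegree + 1 ≤ n ∧
      Ψ = p • Lam (ket (z 0) s) := by
  match ε with
  | 0 =>
    obtain ⟨f, s, -, hn, rfl⟩ := h
    exact ⟨_, s, subst_args_isSymmetric 0 f, hn, rfl⟩
  | 1 =>
    obtain ⟨f, s, -, hn, rfl⟩ := h
    refine ⟨_, s, ?_, hn, rfl⟩
    rw [← comp_args_one]
    exact subst_args_comp_isSymmetric 1 _ f
  | 2 =>
    obtain ⟨f, s, -, hn, rfl⟩ := h
    refine ⟨_, s, ?_, hn, rfl⟩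
    rw [← comp_args_two]
    exact subst_args_comp_isSymmetric 2 _ f

theorem genH_subset (ε : Fin 3) (n : ℕ) :
    genH N k ε n ⊆ ((polyState N k n).map Lam : Submodule ℂ (State N k)) := by
  intro Ψ h
  match ε with
  | 0 =>
    rcases h with ⟨f, s, hn, rfl⟩ | ⟨f, s, -, hn, rfl⟩
    · have hs : (subst ![sig N 1, sig N 2] f).IsSymmetric := by
        rw [← comp_args_zero]
        exact subst_args_comp_isSymmetric 0 _ f
      have e : (z 0 ^ 2 : RatFun N) = ratMap N (X 0 ^ 2) := by rw [map_pow]; rfl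
      rw [e]
      exact smul_Lam_ket_ratMap_mem hs (isHomogeneous_X_pow 0 2).totalDegree_le hn s
    · have hs : (subst ![sig N 1, sig N 2] f).IsSymmetric := by
        rw [← comp_args_zero]
        exact subst_args_comp_isSymmetric 0 _ f
      have e : (z 0 * z 1 : RatFun N) = ratMap N (X 0 * X 1) := by rw [map_mul]; rfl
      rw [e]
      exact smul_Lam_ket_ratMap_mem hs
        ((isHomogeneous_X ℂ 0).mul (isHomogeneous_X ℂ 1)).totalDegree_le hn s
  | 1 => exact h.elim
  | 2 =>
    obtain ⟨f, s, -, hn, rfl⟩ := h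
    have hs : (subst ![sig N 1, tau N N] f).IsSymmetric := by
      rw [← comp_args_two']
      exact subst_args_comp_isSymmetric 2 _ f
    have hd : (∏ i ∈ Finset.univ.erase (0 : Fin N), X i : Poly N).totalDegree ≤ N - 1 := by
      have h := IsHomogeneous.prod (Finset.univ.erase (0 : Fin N)) (fun i => (X i : Poly N))
        (fun _ => 1) fun i _ => isHomogeneous_X ℂ i
      simpa using h.totalDegree_le
    -- The pole of 1/z_1 is cancelled by τ_N, leaving a product of N - 1 variables.
    refine smul_Lam_ket_mem ((tau_isSymmetric N).mul hs)
      (q := (∏ i ∈ Finset.univ.erase (0 : Fin N), X i) * subst ![sig N 1, tau N N] f) ?_ ?_ s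
    · have := NeZero.pos N
      exact (totalDegree_mul _ _).trans (by omega)
    · rw [map_mul, map_mul, ratMap_prod_erase]
      ring

theorem invSpace_le (ε : Fin 3) (n : ℕ) : invSpace N k ε n ≤ (polyState N k n).map Lam := by
  refine Submodule.span_le.mpr ?_
  rintro Ψ ((h | h) | h)
  · obtain ⟨p, s, hp, hn, rfl⟩ := exists_of_mem_genF h
    rw [← map_one (ratMap N)]
    exact smul_Lam_ket_ratMap_mem hp (d := 0) (by simp) hn s
  · obtain ⟨p, s, hp, hn, rfl⟩ := exists_of_mem_genG h
    exact smul_Lam_ket_ratMap_mem hp (isHomogeneous_X ℂ 0).totalDegree_le hn s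
  · exact genH_subset ε n h

theorem monotone_invSpace (ε : Fin 3) : Monotone (invSpace N k ε) := by
  intro m n hmn
  refine Submodule.span_mono ?_
  refine Set.union_subset_union (Set.union_subset_union ?_ ?_) ?_
  · intro Ψ h
    match ε with
    | 0 =>
      obtain ⟨f, s, h1, hn, rfl⟩ := h
      exact ⟨f, s, h1, hn.trans hmn, rfl⟩
    | 1 | 2 =>
      obtain ⟨f, s, h1, h2, hn, rfl⟩ := h
      exact ⟨f, s, h1, h2, hn.trans hmn, rfl⟩
  · intro Ψ h
    match ε with
    | 0 | 1 | 2 =>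
      obtain ⟨f, s, h1, hn, rfl⟩ := h
      exact ⟨f, s, h1, hn.trans hmn, rfl⟩
  · intro Ψ h
    match ε with
    | 0 =>
      rcases h with ⟨f, s, hn, rfl⟩ | ⟨f, s, hs, hn, rfl⟩
      · exact Or.inl ⟨f, s, hn.trans hmn, rfl⟩
      · exact Or.inr ⟨f, s, hs, hn.trans hmn, rfl⟩
    | 1 => exact h.elim
    | 2 =>
      obtain ⟨f, s, h1, hn, rfl⟩ := h
      exact ⟨f, s, h1, hn.trans (by omega), rfl⟩

/-! ### Strictness -/

theorem Lam_ket_z_mem (ε : Fin 3) {n : ℕ} (hn : 1 ≤ n) (s : Spin N k) :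
    Lam (ket (z 0) s) ∈ invSpace N k ε n := by
  have e {r : ℕ} (u : Fin r → Poly N) : subst u 1 = 1 := map_one _
  have h1 {r : ℕ} (i : Fin r) : pd2 i 1 = 0 := by simp [pd2]
  refine Submodule.subset_span (Or.inl (Or.inr ?_))
  match ε with
  | 0 => exact ⟨1, s, h1 _, by rw [e, totalDegree_one]; omega, by rw [e, one_smul]⟩
  | 1 => exact ⟨1, s, h1 _, by rw [e, totalDegree_one]; omega, by rw [e, one_smul]⟩
  | 2 => exact ⟨1, s, h1 _, by rw [e, totalDegree_one]; omega, by rw [e, one_smul]⟩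

theorem factorized_lt (hN : 2 ≤ N) (hk : 1 ≤ k) (ε : Fin 3) {n : ℕ} (hn : 1 ≤ n) :
    factorized N k ε n < invSpace N k ε n := by
  refine lt_of_le_of_ne (Submodule.span_mono (Set.subset_union_left.trans
    Set.subset_union_left)) fun heq => ?_
  -- One site differs from all the others, so the permutations fixing this configuration are those
  -- fixing site 0. The corresponding coordinate of Λ(z_1|c⟩) is a nonzero multiple of z_1 alone,
  -- which is not symmetric.
  let c : Config N k := fun i => if i = 0 then 1 else 0
  have h10 : (1 : Fin (k + 1)) ≠ 0 := by
    intro h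
    have := congrArg Fin.val h
    rw [Fin.val_one', Fin.val_zero, Nat.mod_eq_of_lt (by omega)] at this
    omega
  have hc (π : Equiv.Perm (Fin N)) : c ∘ π = c ↔ π 0 = 0 := by
    constructor
    · intro h
      by_contra hne
      have h0 := congrFun h 0
      simp only [Function.comp_apply, c, hne, if_false, if_true] at h0
      exact h10 h0.symm
    · intro h
      funext i
      have : π i = 0 ↔ i = 0 := by rw [← h, π.injective.eq_iff, h]
      simp [c, this]
  have hmem : Lam (ket (z 0) (Pi.single c 1)) ∈ factorized N k ε n := by
    rw [heq]
    exact Lam_ket_z_mem ε hn _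
  have hval : Lam (ket (z 0) (Pi.single c (1 : ℂ))) c =
      ((N ! : ℂ)⁻¹ * (Finset.univ.filter fun π : Equiv.Perm (Fin N) => π 0 = 0).card) •
        (z 0 : RatFun N) := by
    rw [Lam_ket]
    simp only [Pi.smul_apply, Finset.sum_apply, ket, permSpin, LinearMap.coe_mk, AddHom.coe_mk,
      permVar_z, Pi.single_apply, hc, mul_smul]
    congr 1
    rw [Finset.card_filter, Nat.cast_sum, Finset.sum_smul]
    refine Finset.sum_congr rfl fun π _ => ?_
    split_ifs with h
    · rw [h, Nat.cast_one]
    · simp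
  have hne : ((N ! : ℂ)⁻¹ *
      (Finset.univ.filter fun π : Equiv.Perm (Fin N) => π 0 = 0).card) ≠ 0 := by
    refine mul_ne_zero (inv_ne_zero (Nat.cast_ne_zero.mpr N.factorial_ne_zero))
      (Nat.cast_ne_zero.mpr (Finset.card_ne_zero.mpr ⟨1, by simp⟩))
  have h := permVar_apply_of_mem_factorized hmem (Equiv.swap 0 (0 + 1)) c
  rw [hval, permVar_smul, permVar_swap_z_left] at h
  exact add_one_ne_self hN 0 (z_injective (smul_right_injective _ hne h))

/-! ### Failure of commutation -/

theorem exists_not_commute (hN : 4 ≤ N) (ε : Fin 3) {a : ℝ} (ha : a ≠ 0) :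
    ∃ n : ℕ, ∃ Ψ ∈ polyState N k n, T ε a (Lam Ψ) ≠ Lam (T ε a Ψ) := by
  have hN2 : 2 ≤ N := by omega
  have v1 : ((1 : Fin N) : ℕ) = 1 := by rw [Fin.val_one', Nat.mod_eq_of_lt (by omega)]
  have v2 : ((2 : Fin N) : ℕ) = 2 := Nat.mod_eq_of_lt (by omega : 2 < N)
  have h01 : (0 : Fin N) ≠ 1 := fun h => by
    have := congrArg Fin.val h
    rw [v1, Fin.val_zero] at this
    omega
  have h02 : (0 : Fin N) ≠ 2 := fun h => by
    have := congrArg Fin.val h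
    rw [v2, Fin.val_zero] at this
    omega
  have h12 : (1 : Fin N) ≠ 2 := fun h => by
    have := congrArg Fin.val h
    rw [v1, v2] at this
    omega
  have e11 : (1 : Fin N) + 1 = 2 := Fin.ext (by
    rw [Fin.val_add, v1, v2, Nat.mod_eq_of_lt (by omega)])
  -- Sites 0 and 2 are not neighbours; for N = 3 they would be.
  have h21 : (2 : Fin N) + 1 ≠ 0 := fun h => by
    have := congrArg Fin.val h
    rw [Fin.val_add, v1, v2, Nat.mod_eq_of_lt (by omega), Fin.val_zero] at this
    omega
  let v : Spin N k := fun _ => 1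
  have hperm (f : RatFun N) : Lam (ket (permVar (Equiv.swap 1 2) f) v) = Lam (ket f v) := by
    conv_rhs => rw [← Lam_permState (Equiv.swap 1 2), permState_ket]
    rfl
  have p0 : permVar (Equiv.swap (1 : Fin N) 2) (z 0) = z 0 := permVar_swap_z_of_ne h01 h02
  refine ⟨2, ket (z 0 * z 1 - z 0 * z 2) v, ?_, ?_⟩
  · have e : (z 0 * z 1 - z 0 * z 2 : RatFun N) = ratMap N (X 0 * X 1 - X 0 * X 2) := by
      rw [map_sub, map_mul, map_mul]; rfl
    rw [e]
    exact ket_ratMap_mem_polyState (((isHomogeneous_X ℂ 0).mul (isHomogeneous_X ℂ 1)).sub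
      ((isHomogeneous_X ℂ 0).mul (isHomogeneous_X ℂ 2))).totalDegree_le _
  · have hL : Lam (ket (z 0 * z 1 - z 0 * z 2) v) = 0 := by
      have := hperm (z 0 * z 1)
      rw [map_mul, p0, permVar_swap_z_left] at this
      rw [ket_sub, map_sub, this, sub_self]
    have s1 : ∑ i : Fin N, (if ((0 : Fin N) = i ∧ 1 = i + 1) ∨ ((0 : Fin N) = i + 1 ∧ 1 = i) then
        -theta ε (z i) (z (i + 1)) else 0) = -theta ε (z 0) (z 1) := by
      rw [Finset.sum_eq_single 0]
      · simp
      · intro i _ hi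
        refine if_neg ?_
        rintro (⟨h, -⟩ | ⟨h, rfl⟩)
        · exact hi h.symm
        · exact h02 (h.trans e11)
      · simp
    have s2 : ∑ i : Fin N, (if ((0 : Fin N) = i ∧ 2 = i + 1) ∨ ((0 : Fin N) = i + 1 ∧ 2 = i) then
        -theta ε (z i) (z (i + 1)) else 0) = 0 := by
      refine Finset.sum_eq_zero fun i _ => if_neg ?_
      rintro (⟨rfl, h⟩ | ⟨h, rfl⟩)
      · exact h12 (by rw [h, zero_add])
      · exact h21 h.symm
    -- The contributions not depending on adjacency agree after averaging, so only the ϑ_ε term of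
    -- the neighbouring pair is left.
    have hlin : Lam (ket (linVal ε (z 0) * z 1 + z 0 * linVal ε (z 1)) v) =
        Lam (ket (linVal ε (z 0) * z 2 + z 0 * linVal ε (z 2)) v) := by
      rw [← hperm (linVal ε (z 0) * z 1 + z 0 * linVal ε (z 1)), map_add, map_mul, map_mul,
        ← linVal_permVar, ← linVal_permVar, p0, permVar_swap_z_left]
    have hT : Lam (T ε a (ket (z 0 * z 1 - z 0 * z 2) v)) =
        (-(2 * a) : ℂ) • Lam (ket (theta ε (z 0) (z 1)) v) := by
      rw [T_ket, map_sub, TScalar_z_mul_z hN2 ε a h01, TScalar_z_mul_z hN2 ε a h02, s1, s2,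
        add_zero, ← smul_sub, Lam_ket_smul, two_mul_eq_smul, two_mul_eq_smul, ket_sub, ket_add,
        ket_smul, ket_smul, map_sub, map_add, map_smul, map_smul, hlin,
        ← neg_one_smul ℂ (theta ε (z 0) (z 1)), Lam_ket_smul]
      module
    rw [hL, map_zero, hT]
    refine (smul_ne_zero (neg_ne_zero.mpr (mul_ne_zero two_ne_zero
      (Complex.ofReal_ne_zero.mpr ha))) ?_).symm
    match ε with
    | 0 =>
      have e : theta 0 (z (0 : Fin N)) (z 1) = ratMap N 1 := (map_one _).symm
      rw [e]
      exact Lam_ket_one_ne_zero (by simp)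
    | 1 =>
      have e : theta 1 (z (0 : Fin N)) (z 1) = ratMap N ((1 / 2 : ℂ) • (X 0 + X 1)) := by
        rw [ratMap_smul, Algebra.smul_def, map_add, map_div₀, map_one, map_ofNat, theta]
        change _ = 1 / 2 * (z 0 + z 1)
        ring
      rw [e]
      exact Lam_ket_one_ne_zero (by simp [smul_eval])
    | 2 =>
      have e : theta 2 (z (0 : Fin N)) (z 1) = ratMap N (X 0 * X 1) := (map_mul _ _ _).symm
      rw [e]
      exact Lam_ket_one_ne_zero (by simp)

end

end CyclicDunkl

theorem theorem2 (N k : ℕ) [NeZero N] (hN : 2 ≤ N) (ε : Fin 3) (a : ℝ) :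
    (∀ n : ℕ, ∀ Ψ ∈ invSpace N k ε n, T ε a Ψ ∈ invSpace N k ε n) ∧
    (∀ n : ℕ, FiniteDimensional ℂ (invSpace N k ε n)) ∧
    (∀ n : ℕ, invSpace N k ε n ≤ (polyState N k n).map Lam) ∧
    Monotone (invSpace N k ε) ∧
    (1 ≤ k → ∀ n : ℕ, 1 ≤ n → factorized N k ε n < invSpace N k ε n) ∧
    (4 ≤ N → a ≠ 0 → ∃ n : ℕ, ∃ Ψ ∈ polyState N k n, T ε a (Lam Ψ) ≠ Lam (T ε a Ψ)) := by
  refine ⟨fun n Ψ hΨ => T_mem_invSpace hN ε a n hΨ, fun n => ?_, invSpace_le ε,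
    monotone_invSpace ε, fun hk n hn => factorized_lt hN hk ε hn,
    fun hN4 ha => exists_not_commute hN4 ε ha⟩
  have := finiteDimensional_polyState N k n
  exact Submodule.finiteDimensional_of_le (invSpace_le ε n)
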